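/- **Environment.** There are two players $i\in\{1,2\}$; $-i$ denotes the opponent of $i$. Each player has a finite action set $A_i$, and $u_i:A\to\mathbb R$ is $i$'s payoff function on $A=A_1\times A_2$. Distributions $\alpha\in\Delta(A)$ have marginals $\alpha_i$. **Interdependent-choice equilibrium.** Let $B=B_1\times B_2$ with $B_i\subseteq A_i$ and put $B_i^*=B_i\cup\operatorname{supp}\alpha_i$. A distribution $\alpha\in\Delta(A)$ is an *interdependent-choice equilibrium (ICE) with respect to $B$* if there is $\theta:A\to\Delta(\{1,2\})$ such that for every player $i$ and all $a_i,a_i'\in A_i$ $$\sum_{a_{-i}\in A_{-i}}\alpha(a_i,a_{-i})\Big(u_i(a_i,a_{-i})-\big(1-\theta(i|a)\big)u_i(a_i',a_{-i})-\theta(i|a)\min_{b_{-i}\in B^*_{-i}}u_i(a_i',b_{-i})\Big)\ \ge 0,\qquad a=(a_i,a_{-i}).$$ **C-rationalizability.** Let $A'=A_1'\times A_2'\subseteq A$. An action $a_i^*\in A_i$ is *C-rationalizable with respect to $A'$* if there is a counterfactual belief $\lambda_i:A_i\to\Delta(A_{-i})$ with $\lambda_i(A'_{-i}|a_i)=1$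 for every $a_i\in A_i$ such that $a_i^*$ maximizes $\sum_{a_{-i}}u_i(a_i,a_{-i})\lambda_i(a_{-i}|a_i)$ over $a_i\in A_i$. The set $A'$ is *self-C-rationalizable* if every action profile in $A'$ consists of actions that are C-rationalizable with respect to $A'$. Let $A^{\mathrm{CR}}$ be the largest self-C-rationalizable set. **Extensive form mechanisms.** Consider finite extensive form games $G$ with the two players, Nature, and perfect recall. Nature moves according to a given prior, which may assign probability zero to available moves. Let $Z(y,m)$ denote the set of terminal nodes that can be reached after the move $m$ at the node $y$. Let $\tau$ map the terminal nodes of $G$ onto $A$ so that $i$'s payoff at each terminal node $z$ is $u_i(\tau(z))$. At a decision node $y$ of player $i$, an available move $m$ *represents* $a_i\in A_i$ if $\tau_i(z)=a_i$ for all $z\in Z(y,m)$ and there are an available move $m'$ at $y$ and some $z\in Z(y,m')$ with $\tau_i(z)\ne a_i$. The node $y$ is *pivotal* for $i$ if each $a_i\in A_i$ is represented by some move at $y$. The pair $(G,\tau)$ is an *extensive form mechanism* if the representation relation is the same at all nodes of an information set, and for every terminal node $z$ and every player $i$ there are a pivotal node $y$ for $i$ and a move $m$ that represents $\tau_i(z)$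 at $y$ such that $z\in Z(y,m)$. **Sequential implementation.** A *sequential equilibrium* of $G$ is a pair $(\psi,\sigma)$ of a belief system and a strategy profile that is - *consistent*: there is a single sequence of strictly mixed strategy profiles of the players and Nature that converges to $\sigma$ and to Nature's prior, and whose beliefs by Bayes' rule converge to $\psi$; and - *sequentially rational*: at every information set, every move chosen with positive probability maximizes the mover's expected payoff among all available moves, given his beliefs $\psi$ there and future choices according to $\sigma$ and Nature's prior. A distribution $\alpha\in\Delta(A)$ is *sequentially implementable* if there are an extensive form mechanism $(G,\tau)$ and a sequential equilibrium of $G$ such that, for every $a\in A$, $\alpha(a)$ is the equilibrium probability of reaching a terminal node $z$ with $\tau(z)=a$. **Proposition.** Suppose that $|A_1|=|A_2|=2$ and that there are no repeated payoffs, that is, $u_i(a)\neq u_i(a')$ for each player $i$ and all distinct $a,a'\in A$. Then a distribution $\alpha\in\Delta(A)$ is sequentially implementable if and only if it is an ICE with respect to $A^{\mathrm{CR}}$. -/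

import Mathlib

namespace InterdependentChoice

/-! ## Two-player environments

The players are the elements of `Fin 2`; player `i` has the finite action set `A i`, an action
profile is an element of `∀ i, A i`, and `u i : (∀ i, A i) → ℝ` is the payoff function of `i`. -/

/-- The opponent `-i` of player `i`. -/
def opp : Fin 2 → Fin 2
  | 0 => 1
  | 1 => 0

/-- The action profile `(a_i, a_{-i})`. -/
def pair {A : Fin 2 → Type*} : (i : Fin 2) → A i → A (opp i) → (∀ j, A j)
  | 0, x, y => fun
    | 0 => x
    | 1 => y
  | 1, x, y => fun
    | 0 => y
    | 1 => x

/-- No player is indifferent between two distinct action profiles (no repeated payoffs). -/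
def NoRepeatedPayoffs {A : Fin 2 → Type*} (u : Fin 2 → (∀ i, A i) → ℝ) : Prop :=
  ∀ i, Function.Injective (u i)

/-! ## Interdependent-choice equilibrium -/

/-- The marginal distribution of player `i`'s action. -/
noncomputable def marginal {A : Fin 2 → Type*} [∀ i, Fintype (A i)]
    (α : (∀ i, A i) → ℝ) (i : Fin 2) (x : A i) : ℝ :=
  ∑ y : A (opp i), α (pair i x y)

/-- The effective set of credible threats `B i ∪ supp α_i`. -/
def effectiveThreats {A : Fin 2 → Type*} [∀ i, Fintype (A i)]
    (α : (∀ i, A i) → ℝ) (B : ∀ i, Set (A i)) (i : Fin 2) : Set (A i) :=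
  B i ∪ {x | marginal α i x ≠ 0}

/-- The worst payoff of `i` from `x` when the opponent punishes with an action in `S`
(a minimum, since `S` will be finite and nonempty). -/
noncomputable def worstPayoff {A : Fin 2 → Type*} (u : Fin 2 → (∀ i, A i) → ℝ)
    (i : Fin 2) (x : A i) (S : Set (A (opp i))) : ℝ :=
  sInf ((fun y => u i (pair i x y)) '' S)

/-- The mediated mechanism `(α, θ, B)` is incentive compatible; `θ a i` is the probability that
player `i` is the first to move conditional on the intended action profile being `a`. -/
def IncentiveCompatible {A : Fin 2 → Type*} [∀ i, Fintype (A i)]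
    (u : Fin 2 → (∀ i, A i) → ℝ) (α : (∀ i, A i) → ℝ) (θ : (∀ i, A i) → Fin 2 → ℝ)
    (B : ∀ i, Set (A i)) : Prop :=
  ∀ (i : Fin 2) (x x' : A i),
    0 ≤ ∑ y : A (opp i), α (pair i x y) *
      (u i (pair i x y)
        - (1 - θ (pair i x y) i) * u i (pair i x' y)
        - θ (pair i x y) i * worstPayoff u i x' (effectiveThreats α B (opp i)))

/-- `α` is an interdependent-choice equilibrium with respect to the set `B` of credible threats. -/
def IsICE {A : Fin 2 → Type*} [∀ i, Fintype (A i)]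
    (u : Fin 2 → (∀ i, A i) → ℝ) (B : ∀ i, Set (A i)) (α : (∀ i, A i) → ℝ) : Prop :=
  α ∈ stdSimplex ℝ (∀ i, A i) ∧
    ∃ θ : (∀ i, A i) → Fin 2 → ℝ,
      (∀ a, θ a ∈ stdSimplex ℝ (Fin 2)) ∧ IncentiveCompatible u α θ B

/-! ## Counterfactual rationalizability -/

/-- Expected utility of the action `x` under the counterfactual belief `l`; `l x y` is the
likelihood that the opponent plays `y` if `i` plays `x`. -/
noncomputable def expectedUtility {A : Fin 2 → Type*} [∀ i, Fintype (A i)]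
    (u : Fin 2 → (∀ i, A i) → ℝ) (i : Fin 2) (x : A i) (l : A i → A (opp i) → ℝ) : ℝ :=
  ∑ y : A (opp i), u i (pair i x y) * l x y

/-- The counterfactual beliefs of `i` that put full probability on `S`, whatever `i` plays. -/
def counterfactualBeliefs {A : Fin 2 → Type*} [∀ i, Fintype (A i)]
    (i : Fin 2) (S : Set (A (opp i))) : Set (A i → A (opp i) → ℝ) :=
  {l | ∀ x, l x ∈ stdSimplex ℝ (A (opp i)) ∧ ∀ y, y ∉ S → l x y = 0}

/-- The set of actions of `i` that are C-rationalizable with respect to the action space `A'`. -/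
def cRationalizableIn {A : Fin 2 → Type*} [∀ i, Fintype (A i)]
    (u : Fin 2 → (∀ i, A i) → ℝ) (A' : ∀ i, Set (A i)) (i : Fin 2) : Set (A i) :=
  {x | ∃ l ∈ counterfactualBeliefs i (A' (opp i)),
    ∀ x', expectedUtility u i x' l ≤ expectedUtility u i x l}

/-- The product set with factors `A' i` is self-C-rationalizable. (If one factor is empty, this
forces both of them to be empty.) -/
def SelfCRationalizable {A : Fin 2 → Type*} [∀ i, Fintype (A i)]
    (u : Fin 2 → (∀ i, A i) → ℝ) (A' : ∀ i, Set (A i)) : Prop :=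
  ∀ i, A' i ⊆ cRationalizableIn u A' i

/-- The factors of the largest self-C-rationalizable set of action profiles. -/
def cRationalizable {A : Fin 2 → Type*} [∀ i, Fintype (A i)]
    (u : Fin 2 → (∀ i, A i) → ℝ) (i : Fin 2) : Set (A i) :=
  {x | ∃ A' : ∀ i, Set (A i), SelfCRationalizable u A' ∧ x ∈ A' i}

theorem isGreatest_cRationalizable {A : Fin 2 → Type*} [∀ i, Fintype (A i)]
    (u : Fin 2 → (∀ i, A i) → ℝ) :
    IsGreatest {A' | SelfCRationalizable u A'} (cRationalizable u) := by
  constructor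
  · rintro i x ⟨A', hA', hx⟩
    obtain ⟨l, hl, hmax⟩ := hA' i hx
    refine ⟨l, fun x' => ⟨(hl x').1, fun y hy => (hl x').2 y fun hy' => hy ⟨A', hA', hy'⟩⟩, hmax⟩
  · intro A' hA' i x hx
    exact ⟨A', hA', hx⟩

/-! ## Finite extensive form games with perfect recall -/

/-- The tree, the movers and the information sets of a finite two-player extensive form.
A node is the history of the moves made so far, LATEST MOVE FIRST: `m :: x` is the node reached
from `x` by the move `m`, and `x` precedes `z` if and only if `x <:+ z`. -/
structure GameTree (M H : Type) where
  nodes : Finset (List M)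
  root_mem : [] ∈ nodes
  pred_mem : ∀ (m : M) (x : List M), m :: x ∈ nodes → x ∈ nodes
  /-- The agent who moves at a non-terminal node; `none` stands for Nature. -/
  mover : List M → Option (Fin 2)
  /-- The information sets of player `i` are the sets of those decision nodes of `i` at which
  `info i` takes a given value. -/
  info : Fin 2 → List M → H

namespace GameTree

variable {M H : Type}

/-- The node `x` is non-terminal. -/
def IsInner (G : GameTree M H) (x : List M) : Prop :=
  x ∈ G.nodes ∧ ∃ m, m :: x ∈ G.nodes

/-- `x` is a decision node of player `i`. -/
def IsDecision (G : GameTree M H) (i : Fin 2) (x : List M) : Prop :=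
  G.IsInner x ∧ G.mover x = some i

/-- The finite set of terminal nodes. -/
noncomputable def terminals (G : GameTree M H) : Finset (List M) :=
  open scoped Classical in G.nodes.filter fun z => ∀ m, m :: z ∉ G.nodes

/-- The information set of `i` that contains the decision node `y`. -/
noncomputable def infoSet (G : GameTree M H) (i : Fin 2) (y : List M) : Finset (List M) :=
  open scoped Classical in
    G.nodes.filter fun x => G.IsDecision i x ∧ G.info i x = G.info i y

/-- The record of player `i` along a history: the information sets at which `i` has moved and
the moves made there (latest first). -/
def experience (G : GameTree M H) (i : Fin 2) : List M → List (H × M)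
  | [] => []
  | m :: x =>
    if G.mover x = some i then (G.info i x, m) :: experience G i x else experience G i x

/-- `p` is a distribution over the moves that are available at `x`. -/
def IsMoveDist [Fintype M] (G : GameTree M H) (x : List M) (p : M → ℝ) : Prop :=
  p ∈ stdSimplex ℝ M ∧ ∀ m, m :: x ∉ G.nodes → p m = 0

end GameTree

/-- Finite two-player extensive form games with perfect recall. The prior `chance` on the choices
of Nature may assign probability zero to available moves. -/
structure ExtensiveGame (M H : Type) [Fintype M] extends GameTree M H where
  moves_eq : ∀ (i : Fin 2) (x y : List M), toGameTree.IsDecision i x → toGameTree.IsDecision i y →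
    info i x = info i y → ∀ m, m :: x ∈ nodes ↔ m :: y ∈ nodes
  perfect_recall : ∀ (i : Fin 2) (x y : List M),
    toGameTree.IsDecision i x → toGameTree.IsDecision i y →
    info i x = info i y → toGameTree.experience i x = toGameTree.experience i y
  chance : List M → M → ℝ
  chance_dist : ∀ x, toGameTree.IsInner x → mover x = none → toGameTree.IsMoveDist x (chance x)
  payoff : Fin 2 → List M → ℝ

namespace ExtensiveGame

variable {M H : Type} [Fintype M]

/-- A profile of behavior strategies, one for each player and one for Nature: `σ x m` is the
probability of the move `m` at the node `x`. The players' behavior is the same at all nodes of an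
information set; Nature's nodes are all distinguished. -/
structure IsProfile (G : ExtensiveGame M H) (σ : List M → M → ℝ) : Prop where
  dist : ∀ x, G.IsInner x → G.IsMoveDist x (σ x)
  info_const : ∀ i x y, G.IsDecision i x → G.IsDecision i y → G.info i x = G.info i y → σ x = σ y

/-- Every available move of every player and of Nature has positive probability. -/
def IsStrictlyMixed (G : ExtensiveGame M H) (σ : List M → M → ℝ) : Prop :=
  ∀ x m, m :: x ∈ G.nodes → 0 < σ x m

/-- The probability of reaching the node `z` from the node `x` (zero if `x` does not precede `z`). -/
noncomputable def transition (σ : List M → M → ℝ) (x : List M) : List M → ℝ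
  | [] => open scoped Classical in if x = [] then 1 else 0
  | m :: z =>
    open scoped Classical in if x = m :: z then 1 else transition σ x z * σ z m

/-- The probability that the node `z` is reached. -/
noncomputable def reach (σ : List M → M → ℝ) (z : List M) : ℝ :=
  transition σ [] z

/-- A belief system `ψ` assigns to each decision node `y` of a player `i` the probability `ψ y` of
being at `y` given that the information set of `y` has been reached. This says that `ψ` comes
from `σ` by Bayes' rule; it is only used for strictly mixed `σ`. -/
def BayesRule (G : ExtensiveGame M H) (ψ : List M → ℝ) (σ : List M → M → ℝ) : Prop :=
  ∀ i y, G.IsDecision i y → ψ y = reach σ y / ∑ x ∈ G.infoSet i y, reach σ x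

/-- Consistency: one and the same sequence of strictly mixed assessments, in which Nature
trembles as well, approximates the beliefs and the strategies. -/
def IsConsistent (G : ExtensiveGame M H) (ψ : List M → ℝ) (σ : List M → M → ℝ) : Prop :=
  ∃ (ψs : ℕ → List M → ℝ) (σs : ℕ → List M → M → ℝ),
    (∀ n, G.IsProfile (σs n) ∧ G.IsStrictlyMixed (σs n) ∧ G.BayesRule (ψs n) (σs n)) ∧
    (∀ x, G.IsInner x → ∀ m,
      Filter.Tendsto (fun n => σs n x m) Filter.atTop (nhds (σ x m))) ∧
    (∀ i y, G.IsDecision i y →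
      Filter.Tendsto (fun n => ψs n y) Filter.atTop (nhds (ψ y)))

/-- The expected payoff of `i` from the move `m` at his information set containing `y`, given his
beliefs `ψ` there and if all later choices are made according to `σ`. -/
noncomputable def moveValue (G : ExtensiveGame M H) (ψ : List M → ℝ) (σ : List M → M → ℝ)
    (i : Fin 2) (y : List M) (m : M) : ℝ :=
  ∑ x ∈ G.infoSet i y, ψ x * ∑ z ∈ G.terminals, transition σ (m :: x) z * G.payoff i z

/-- At every information set, on or off the path of play, only optimal moves are used. -/
def IsSequentiallyRational (G : ExtensiveGame M H) (ψ : List M → ℝ) (σ : List M → M → ℝ) : Prop :=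
  ∀ i y, G.IsDecision i y → ∀ m m', m :: y ∈ G.nodes → m' :: y ∈ G.nodes → 0 < σ y m →
    G.moveValue ψ σ i y m' ≤ G.moveValue ψ σ i y m

/-- The assessment `(ψ, σ)` is a sequential equilibrium. -/
structure IsSequentialEquilibrium (G : ExtensiveGame M H) (ψ : List M → ℝ) (σ : List M → M → ℝ) :
    Prop where
  profile : G.IsProfile σ
  nature : ∀ x, G.IsInner x → G.mover x = none → σ x = G.chance x
  consistent : G.IsConsistent ψ σ
  rational : G.IsSequentiallyRational ψ σ

/-! ## Extensive form mechanisms -/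

/-- At the decision node `y` of player `i`, the move `m` represents the action `a`. -/
def Represents {A : Fin 2 → Type*} (G : ExtensiveGame M H) (τ : List M → (∀ i, A i))
    (i : Fin 2) (y : List M) (m : M) (a : A i) : Prop :=
  m :: y ∈ G.nodes ∧
  (∀ z ∈ G.terminals, (m :: y) <:+ z → τ z i = a) ∧
  ∃ m', m' :: y ∈ G.nodes ∧ ∃ z ∈ G.terminals, (m' :: y) <:+ z ∧ τ z i ≠ a

/-- `y` is a pivotal decision node of player `i`. -/
def IsPivotal {A : Fin 2 → Type*} (G : ExtensiveGame M H) (τ : List M → (∀ i, A i))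
    (i : Fin 2) (y : List M) : Prop :=
  G.IsDecision i y ∧ ∀ a : A i, ∃ m, G.Represents τ i y m a

/-- `(G, τ)` is an extensive form mechanism for the environment with payoffs `u`. -/
structure IsMechanism {A : Fin 2 → Type*} (u : Fin 2 → (∀ i, A i) → ℝ)
    (G : ExtensiveGame M H) (τ : List M → (∀ i, A i)) : Prop where
  /-- `τ` maps the terminal nodes onto the action profiles ... -/
  onto : ∀ a, ∃ z ∈ G.terminals, τ z = a
  /-- ... and preserves the preferences. -/
  payoff_eq : ∀ z ∈ G.terminals, ∀ i, G.payoff i z = u i (τ z)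
  full_disclosure : ∀ i x y, G.IsDecision i x → G.IsDecision i y → G.info i x = G.info i y →
    ∀ (m : M) (a : A i), G.Represents τ i x m a ↔ G.Represents τ i y m a
  /-- Along every play, every player makes a pivotal move at a pivotal node. -/
  pivotal : ∀ z ∈ G.terminals, ∀ i, ∃ y m, G.IsPivotal τ i y ∧
    G.Represents τ i y m (τ z i) ∧ (m :: y) <:+ z

end ExtensiveGame

/-- The distribution `α` over action profiles is sequentially implementable: it is induced by a
sequential equilibrium of some extensive form mechanism. -/
def SequentiallyImplementable {A : Fin 2 → Type*} (u : Fin 2 → (∀ i, A i) → ℝ)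
    (α : (∀ i, A i) → ℝ) : Prop :=
  ∃ (M H : Type) (_ : Fintype M) (G : ExtensiveGame M H) (τ : List M → (∀ i, A i))
    (ψ : List M → ℝ) (σ : List M → M → ℝ),
    G.IsMechanism u τ ∧ G.IsSequentialEquilibrium ψ σ ∧
    ∀ a, α a = open scoped Classical in
      ∑ z ∈ G.terminals, if τ z = a then ExtensiveGame.reach σ z else 0

end InterdependentChoice

/-! ### Players and action profiles. -/

namespace InterdependentChoice

/-! The proof splits on whether some player has an action `d` whose best payoff is below the worst
payoff of his other action `d'` (`IsAbsolutelyDominated`).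

Suppose there is such an action. It is not C-rationalizable, it has probability zero under an ICE,
and no sequential equilibrium chooses it at a pivotal node, even off the path. So that player always
plays `d'`, and `d'` is the only threat the opponent faces. The opponent's deviation payoffs then do
not depend on who moves first, so he best responds to `d'`. Without repeated payoffs his best
response is unique, and both conditions force `α` to be a point mass on a pure Nash equilibrium.
Conversely such a point mass is an ICE for every `B`, and it is implemented by a game in which
Nature has a single plan.

Suppose there is no such action. Then every action is C-rationalizable: hold the most optimistic
belief about it and a pessimistic one about each alternative. What remains is an equivalence with
unrestricted threats.

Necessity: along every play each player has exactly one pivotal move, and exactly one of the two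
players moves while the action of the other is still open. Let `θ(i|a)` be the conditional
probability that this player is `i`. A deviator who moves second leaves the opponent's action as it
is; one who moves first gets at least the worst payoff. Adding the equilibrium conditions over
information sets, weighted by reach probabilities, gives the ICE inequality
(`IsMechanism.exists_incentiveCompatible`).

Sufficiency: Nature draws the profile from `α` and the first mover from `θ`. Players hear only a
recommendation and do not learn their position; a deviation by the first mover triggers the
recommendation of the harshest action. For recommendations used on the path, obedience is the ICE
inequality. A player told to use an unused action `c` is made to believe that he moves first and
that obedience earns the best payoff from `c`, while deviation earns the worst payoff from the
alternative; absence of absolute domination makes obedience optimal. Trembles of Nature of different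
orders generate these beliefs for both players at once, if one player can be given priority
(`obedientOffPath_of_unused`). If neither can, `α` is again a point mass on a pure Nash equilibrium
(`exists_priority_or_isPureNash`). -/

@[simp] theorem opp_opp (i : Fin 2) : opp (opp i) = i := by fin_cases i <;> rfl

theorem opp_ne (i : Fin 2) : opp i ≠ i := by fin_cases i <;> decide

theorem eq_or_eq_opp (i j : Fin 2) : j = i ∨ j = opp i := by
  fin_cases i <;> fin_cases j <;> decide

theorem forall_player {P : Fin 2 → Prop} (i : Fin 2) : (∀ j, P j) ↔ P i ∧ P (opp i) := by
  refine ⟨fun h => ⟨h _, h _⟩, fun h j => ?_⟩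
  rcases eq_or_eq_opp i j with rfl | rfl
  exacts [h.1, h.2]

theorem sum_player {R : Type*} [AddCommMonoid R] (i : Fin 2) (f : Fin 2 → R) :
    ∑ j, f j = f i + f (opp i) := by
  fin_cases i
  · simp [Fin.sum_univ_two, opp]
  · simp [Fin.sum_univ_two, opp, add_comm]

section Pair

variable {A : Fin 2 → Type*}

@[simp] theorem pair_self (i : Fin 2) (x : A i) (y : A (opp i)) : pair i x y i = x := by
  match i, x, y with
  | 0, _, _ => rfl
  | 1, _, _ => rfl

@[simp] theorem pair_opp (i : Fin 2) (x : A i) (y : A (opp i)) : pair i x y (opp i) = y := by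
  match i, x, y with
  | 0, _, _ => rfl
  | 1, _, _ => rfl

theorem profile_ext (i : Fin 2) {a b : ∀ j, A j} (h : a i = b i) (h' : a (opp i) = b (opp i)) :
    a = b :=
  funext ((forall_player i).2 ⟨h, h'⟩)

@[simp] theorem pair_eta (i : Fin 2) (a : ∀ j, A j) : pair i (a i) (a (opp i)) = a :=
  profile_ext i (by simp) (by simp)

theorem pair_eq_iff (i : Fin 2) {x : A i} {y : A (opp i)} {a : ∀ j, A j} :
    pair i x y = a ↔ x = a i ∧ y = a (opp i) := by
  constructor
  · rintro rfl
    simp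
  · rintro ⟨rfl, rfl⟩
    simp

theorem sum_pair [∀ i, Fintype (A i)] {R : Type*} [AddCommMonoid R] (i : Fin 2)
    (f : (∀ j, A j) → R) : ∑ a, f a = ∑ x, ∑ y, f (pair i x y) := by
  rw [← Fintype.sum_prod_type']
  refine Fintype.sum_equiv
    ⟨fun a => (a i, a (opp i)), fun p => pair i p.1 p.2, fun a => by simp, fun p => by simp⟩ _ _ ?_
  intro a
  simp

end Pair

/-! ### Transition probabilities along histories. -/

namespace ExtensiveGame

variable {M H : Type}

section Transition

variable (σ : List M → M → ℝ)

@[simp] theorem transition_self (x : List M) : transition σ x x = 1 := by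
  cases x <;> simp [transition]

theorem transition_nil_right {x : List M} (h : x ≠ []) : transition σ x [] = 0 := by
  simp [transition, h]

theorem transition_cons {x z : List M} {m : M} (h : x ≠ m :: z) :
    transition σ x (m :: z) = transition σ x z * σ z m := by
  simp [transition, h]

variable {σ}

theorem suffix_of_transition_ne_zero {x z : List M} (h : transition σ x z ≠ 0) : x <:+ z := by
  induction z with
  | nil =>
    by_cases hx : x = []
    · simp [hx]
    · exact absurd (transition_nil_right σ hx) h
  | cons m z ih =>
    by_cases hx : x = m :: z
    · simp [hx]
    · rw [transition_cons σ hx] at h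
      exact (ih (left_ne_zero_of_mul h)).trans (List.suffix_cons m z)

theorem transition_eq_zero {x z : List M} (h : ¬ x <:+ z) : transition σ x z = 0 := by
  by_contra h'
  exact h (suffix_of_transition_ne_zero h')

variable (σ)

theorem transition_mul {x y z : List M} (hxy : x <:+ y) (hyz : y <:+ z) :
    transition σ x z = transition σ x y * transition σ y z := by
  induction z with
  | nil =>
    obtain rfl := List.suffix_nil.1 hyz
    simp
  | cons m z ih =>
    rcases List.suffix_cons_iff.1 hyz with rfl | hy
    · simp
    · have h1 : x ≠ m :: z := by
        rintro rfl
        have := (hxy.trans hy).length_le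
        simp at this
      have h2 : y ≠ m :: z := by
        rintro rfl
        have := hy.length_le
        simp at this
      rw [transition_cons σ h1, transition_cons σ h2, ih hy, mul_assoc]

/-- `transition` is defined by recursion on the last move; this is the decomposition by the first
move, which backward induction needs. -/
theorem transition_step [Fintype M] {x z : List M} (h : z ≠ x) :
    transition σ x z = ∑ m, σ x m * transition σ (m :: x) z := by
  classical
  induction z with
  | nil =>
    rw [transition_nil_right σ h.symm]
    simp [transition_nil_right]
  | cons m' z ih =>
    rw [transition_cons σ h.symm]
    by_cases hz : z = x
    · subst hz
      rw [transition_self, one_mul, Finset.sum_eq_single m']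
      · simp
      · intro m _ hm
        rw [transition_eq_zero, mul_zero]
        intro hs
        have := hs.eq_of_length (by simp)
        simp_all
      · simp
    · rw [ih hz, Finset.sum_mul]
      refine Finset.sum_congr rfl fun m _ => ?_
      rw [mul_assoc]
      by_cases hm : m :: x = m' :: z
      · simp_all
      · rw [transition_cons σ hm]

theorem reach_cons (x : List M) (m : M) : reach σ (m :: x) = reach σ x * σ x m :=
  transition_cons σ (by simp)

@[simp] theorem reach_nil : reach σ ([] : List M) = 1 := transition_self σ []

theorem reach_mul {y z : List M} (hyz : y <:+ z) :
    reach σ z = reach σ y * transition σ y z :=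
  transition_mul σ (List.nil_suffix) hyz

theorem move_comparable {m m' : M} {y y' z : List M} (h : (m :: y) <:+ z)
    (h' : (m' :: y') <:+ z) :
    (y = y' ∧ m = m') ∨ (m :: y) <:+ y' ∨ (m' :: y') <:+ y := by
  rcases List.suffix_or_suffix_of_suffix h h' with h | h
  · rcases List.suffix_cons_iff.1 h with h | h
    · simp_all
    · exact .inr (.inl h)
  · rcases List.suffix_cons_iff.1 h with h | h
    · simp_all
    · exact .inr (.inr h)

end Transition

end ExtensiveGame

/-! ### Finite trees, terminal nodes and information sets. -/

namespace GameTree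

variable {M H : Type} (G : GameTree M H)

/-- Backward induction. The tree is finite, so the gap between the length of a history and the
maximal length is a decreasing measure. -/
theorem node_induction {P : List M → Prop}
    (h : ∀ x ∈ G.nodes, (∀ m, m :: x ∈ G.nodes → P (m :: x)) → P x) : ∀ x ∈ G.nodes, P x := by
  have key : ∀ n : ℕ, ∀ x ∈ G.nodes, G.nodes.sup List.length ≤ x.length + n → P x := by
    intro n
    induction n with
    | zero =>
      intro x hx hn
      refine h x hx fun m hm => ?_
      have := Finset.le_sup (f := List.length) hm
      simp only [List.length_cons] at this
      omega
    | succ n ih =>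
      intro x hx hn
      refine h x hx fun m hm => ih _ hm ?_
      simp only [List.length_cons]
      omega
  exact fun x hx => key _ x hx (Nat.le_add_left _ _)

theorem isInner_of_cons {m : M} {x : List M} (h : m :: x ∈ G.nodes) : G.IsInner x :=
  ⟨G.pred_mem _ _ h, m, h⟩

theorem mem_terminals {z : List M} : z ∈ G.terminals ↔ z ∈ G.nodes ∧ ∀ m, m :: z ∉ G.nodes := by
  simp [terminals]

theorem mem_terminals_or_isInner {x : List M} (h : x ∈ G.nodes) :
    x ∈ G.terminals ∨ G.IsInner x := by
  rw [mem_terminals]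
  by_cases h' : ∃ m, m :: x ∈ G.nodes
  · exact .inr ⟨h, h'⟩
  · exact .inl ⟨h, by simpa using h'⟩

theorem exists_terminal {x : List M} (h : x ∈ G.nodes) : ∃ z ∈ G.terminals, x <:+ z := by
  refine G.node_induction (P := fun x => ∃ z ∈ G.terminals, x <:+ z) (fun x hx ih => ?_) x h
  rcases G.mem_terminals_or_isInner hx with ht | ⟨_, m, hm⟩
  · exact ⟨x, ht, List.suffix_rfl⟩
  · obtain ⟨z, hz, hs⟩ := ih m hm
    exact ⟨z, hz, (List.suffix_cons m x).trans hs⟩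

theorem eq_of_terminal_suffix {x z : List M} (hx : x ∈ G.terminals) (hz : z ∈ G.nodes)
    (h : x <:+ z) : z = x := by
  induction z with
  | nil => exact (List.suffix_nil.1 h).symm
  | cons m z ih =>
    rcases List.suffix_cons_iff.1 h with rfl | h
    · rfl
    · have := ih (G.pred_mem _ _ hz) h
      subst this
      exact absurd hz ((G.mem_terminals.1 hx).2 m)

theorem mem_infoSet {i : Fin 2} {x y : List M} :
    x ∈ G.infoSet i y ↔ G.IsDecision i x ∧ G.info i x = G.info i y := by
  simp only [infoSet, Finset.mem_filter, and_iff_right_iff_imp]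
  exact fun h => h.1.1.1

theorem self_mem_infoSet {i : Fin 2} {y : List M} (h : G.IsDecision i y) : y ∈ G.infoSet i y :=
  G.mem_infoSet.2 ⟨h, rfl⟩

theorem infoSet_congr {i : Fin 2} {x y : List M} (h : G.info i x = G.info i y) :
    G.infoSet i x = G.infoSet i y := by
  ext z
  simp only [mem_infoSet, h]

end GameTree

/-! ### Continuation values. -/

namespace ExtensiveGame

variable {M H : Type} [Fintype M] (G : ExtensiveGame M H)

/-- The expectation of `f` at the terminal node that is reached from `x`. -/
noncomputable def continuation (σ : List M → M → ℝ) (f : List M → ℝ) (x : List M) : ℝ :=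
  ∑ z ∈ G.terminals, transition σ x z * f z

theorem moveValue_eq (ψ : List M → ℝ) (σ : List M → M → ℝ) (i : Fin 2) (y : List M) (m : M) :
    G.moveValue ψ σ i y m =
      ∑ x ∈ G.infoSet i y, ψ x * G.continuation σ (G.payoff i) (m :: x) := rfl

variable {G} {σ : List M → M → ℝ}

theorem continuation_terminal (f : List M → ℝ) {x : List M} (hx : x ∈ G.terminals) :
    G.continuation σ f x = f x := by
  rw [continuation, Finset.sum_eq_single_of_mem x hx, transition_self, one_mul]
  intro z hz hzx
  rw [transition_eq_zero, zero_mul]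
  exact fun h => hzx (G.eq_of_terminal_suffix hx (G.mem_terminals.1 hz).1 h)

theorem continuation_inner (f : List M → ℝ) {x : List M} (hx : G.IsInner x) :
    G.continuation σ f x = ∑ m, σ x m * G.continuation σ f (m :: x) := by
  simp only [continuation, Finset.mul_sum]
  rw [Finset.sum_comm]
  refine Finset.sum_congr rfl fun z hz => ?_
  rw [transition_step, Finset.sum_mul]
  · simp only [mul_assoc]
  · rintro rfl
    obtain ⟨_, m, hm⟩ := hx
    exact (G.mem_terminals.1 hz).2 m hm

namespace IsProfile

theorem nonneg (h : G.IsProfile σ) {x : List M} (hx : G.IsInner x) (m : M) : 0 ≤ σ x m :=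
  (h.dist x hx).1.1 m

theorem sum_eq_one (h : G.IsProfile σ) {x : List M} (hx : G.IsInner x) : ∑ m, σ x m = 1 :=
  (h.dist x hx).1.2

theorem transition_nonneg (h : G.IsProfile σ) (x : List M) {z : List M} (hz : z ∈ G.nodes) :
    0 ≤ transition σ x z := by
  induction z with
  | nil =>
    by_cases hx : x = []
    · simp [hx]
    · rw [transition_nil_right σ hx]
  | cons m z ih =>
    by_cases hx : x = m :: z
    · simp [hx]
    · rw [transition_cons σ hx]
      exact mul_nonneg (ih (G.pred_mem _ _ hz)) (h.nonneg (G.isInner_of_cons hz) m)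

theorem reach_nonneg (h : G.IsProfile σ) {z : List M} (hz : z ∈ G.nodes) : 0 ≤ reach σ z :=
  h.transition_nonneg [] hz

theorem reach_pos (h : G.IsStrictlyMixed σ) {z : List M} (hz : z ∈ G.nodes) : 0 < reach σ z := by
  induction z with
  | nil => simp
  | cons m z ih =>
    rw [reach_cons]
    exact mul_pos (ih (G.pred_mem _ _ hz)) (h _ _ hz)

theorem continuation_one (h : G.IsProfile σ) :
    ∀ x ∈ G.nodes, G.continuation σ (fun _ => 1) x = 1 := by
  refine G.node_induction fun x hx ih => ?_
  rcases G.mem_terminals_or_isInner hx with ht | hi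
  · exact continuation_terminal _ ht
  · rw [continuation_inner _ hi]
    refine Eq.trans ?_ (h.sum_eq_one hi)
    refine Finset.sum_congr rfl fun m _ => ?_
    by_cases hm : m :: x ∈ G.nodes
    · rw [ih m hm, mul_one]
    · rw [(h.dist x hi).2 m hm, zero_mul]

theorem le_continuation (h : G.IsProfile σ) {x : List M} (hx : x ∈ G.nodes) {f : List M → ℝ}
    {c : ℝ} (hc : ∀ z ∈ G.terminals, x <:+ z → transition σ x z ≠ 0 → c ≤ f z) :
    c ≤ G.continuation σ f x := by
  calc c = ∑ z ∈ G.terminals, transition σ x z * c := by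
        rw [← Finset.sum_mul]
        have := h.continuation_one x hx
        simp only [continuation, mul_one] at this
        rw [this, one_mul]
    _ ≤ _ := by
        refine Finset.sum_le_sum fun z hz => ?_
        by_cases ht : transition σ x z = 0
        · simp [ht]
        · exact mul_le_mul_of_nonneg_left (hc z hz (suffix_of_transition_ne_zero ht) ht)
            (h.transition_nonneg x (G.mem_terminals.1 hz).1)

theorem continuation_neg (f : List M → ℝ) (x : List M) :
    G.continuation σ (fun z => - f z) x = - G.continuation σ f x := by
  simp [continuation]

theorem continuation_le (h : G.IsProfile σ) {x : List M} (hx : x ∈ G.nodes) {f : List M → ℝ}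
    {c : ℝ} (hc : ∀ z ∈ G.terminals, x <:+ z → transition σ x z ≠ 0 → f z ≤ c) :
    G.continuation σ f x ≤ c := by
  have := h.le_continuation hx (f := fun z => - f z) (c := -c)
    fun z hz hs ht => neg_le_neg (hc z hz hs ht)
  rw [continuation_neg] at this
  exact neg_le_neg_iff.1 this

end IsProfile

theorem tendsto_reach {σs : ℕ → List M → M → ℝ}
    (h : ∀ x, G.IsInner x → ∀ m,
      Filter.Tendsto (fun n => σs n x m) Filter.atTop (nhds (σ x m)))
    {z : List M} (hz : z ∈ G.nodes) :
    Filter.Tendsto (fun n => reach (σs n) z) Filter.atTop (nhds (reach σ z)) := by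
  induction z with
  | nil => simp
  | cons m z ih =>
    simp only [reach_cons]
    exact (ih (G.pred_mem _ _ hz)).mul (h z (G.isInner_of_cons hz) m)

end ExtensiveGame

end InterdependentChoice

namespace InterdependentChoice

theorem sum_nonneg_of_fiberwise {ι κ : Type*} [DecidableEq κ] (s : Finset ι) (k : ι → κ)
    (f : ι → ℝ) (h : ∀ p ∈ s, 0 ≤ ∑ q ∈ s with k q = k p, f q) : 0 ≤ ∑ p ∈ s, f p := by
  rw [← Finset.sum_fiberwise_of_maps_to (t := s.image k)
    (fun p hp => Finset.mem_image_of_mem k hp)]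
  refine Finset.sum_nonneg fun c hc => ?_
  obtain ⟨p, hp, rfl⟩ := Finset.mem_image.1 hc
  exact h p hp

namespace ExtensiveGame

variable {M H : Type} [Fintype M] {G : ExtensiveGame M H} {σ : List M → M → ℝ} {ψ : List M → ℝ}

/-! ### Beliefs in a consistent assessment. -/

section Beliefs

open Filter Topology

theorem sum_reach_infoSet_pos (h : G.IsStrictlyMixed σ) {i : Fin 2} {y : List M}
    (hy : G.IsDecision i y) : 0 < ∑ x ∈ G.infoSet i y, reach σ x :=
  Finset.sum_pos (fun _ hx => IsProfile.reach_pos h (G.mem_infoSet.1 hx).1.1.1)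
    ⟨y, G.self_mem_infoSet hy⟩

/-- Bayes' rule with the denominator cleared survives the limit at every information set, including
those reached with probability zero. -/
theorem IsConsistent.belief_mul_reach (h : G.IsConsistent ψ σ) {i : Fin 2} {y : List M}
    (hy : G.IsDecision i y) : ψ y * ∑ x ∈ G.infoSet i y, reach σ x = reach σ y := by
  obtain ⟨ψs, σs, h1, h2, h3⟩ := h
  have hl : Tendsto (fun n => ψs n y * ∑ x ∈ G.infoSet i y, reach (σs n) x) atTop
      (𝓝 (ψ y * ∑ x ∈ G.infoSet i y, reach σ x)) :=
    (h3 i y hy).mul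
      (tendsto_finsetSum _ fun x hx => tendsto_reach h2 (G.mem_infoSet.1 hx).1.1.1)
  refine tendsto_nhds_unique hl ((tendsto_reach h2 hy.1.1).congr fun n => ?_)
  rw [(h1 n).2.2 i y hy, div_mul_cancel₀ _ (sum_reach_infoSet_pos (h1 n).2.1 hy).ne']

theorem IsConsistent.belief_nonneg (h : G.IsConsistent ψ σ) {i : Fin 2} {y : List M}
    (hy : G.IsDecision i y) : 0 ≤ ψ y := by
  obtain ⟨ψs, σs, h1, h2, h3⟩ := h
  refine ge_of_tendsto' (h3 i y hy) fun n => ?_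
  rw [(h1 n).2.2 i y hy]
  exact div_nonneg ((h1 n).1.reach_nonneg hy.1.1) (sum_reach_infoSet_pos (h1 n).2.1 hy).le

theorem IsConsistent.sum_belief (h : G.IsConsistent ψ σ) {i : Fin 2} {y : List M}
    (hy : G.IsDecision i y) : ∑ x ∈ G.infoSet i y, ψ x = 1 := by
  obtain ⟨ψs, σs, h1, h2, h3⟩ := h
  refine tendsto_nhds_unique
    (tendsto_finsetSum _ fun x hx => h3 i x (G.mem_infoSet.1 hx).1)
    (tendsto_const_nhds.congr fun n => ?_)
  rw [← div_self (sum_reach_infoSet_pos (h1 n).2.1 hy).ne', Finset.sum_div]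
  refine Finset.sum_congr rfl fun x hx => ?_
  rw [(h1 n).2.2 i x (G.mem_infoSet.1 hx).1, G.infoSet_congr (G.mem_infoSet.1 hx).2]

end Beliefs

/-! ### Equilibrium outcomes of mechanisms satisfy the incentive constraints. -/

section Mechanism

variable {A : Fin 2 → Type*} {τ : List M → (∀ i, A i)} {u : Fin 2 → (∀ i, A i) → ℝ}

/-- The action of player `i` is the same at all terminal nodes that follow `y`. -/
def IsDetermined (G : ExtensiveGame M H) (τ : List M → (∀ i, A i)) (i : Fin 2)
    (y : List M) : Prop :=
  ∃ a, ∀ z ∈ G.terminals, y <:+ z → τ z i = a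

theorem IsDetermined.mono {i : Fin 2} {y y' : List M} (h : G.IsDetermined τ i y)
    (hy : y <:+ y') : G.IsDetermined τ i y' :=
  h.imp fun _ ha z hz hs => ha z hz (hy.trans hs)

theorem Represents.isDetermined {i : Fin 2} {y y' : List M} {m : M} {a : A i}
    (h : G.Represents τ i y m a) (hy : (m :: y) <:+ y') : G.IsDetermined τ i y' :=
  ⟨a, fun z hz hs => h.2.1 z hz (hy.trans hs)⟩

theorem IsPivotal.not_isDetermined [∀ i, Nontrivial (A i)] {i : Fin 2} {y : List M}
    (h : G.IsPivotal τ i y) : ¬ G.IsDetermined τ i y := by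
  rintro ⟨b, hb⟩
  obtain ⟨a, hab⟩ := exists_ne b
  obtain ⟨m, hm⟩ := h.2 a
  obtain ⟨z, hz, hs⟩ := G.exists_terminal hm.1
  exact hab ((hm.2.1 z hz hs).symm.trans (hb z hz ((List.suffix_cons m y).trans hs)))

theorem IsPivotal.unique [∀ i, Nontrivial (A i)] {i : Fin 2} {y y' z : List M} {m m' : M}
    {a a' : A i} (hy : G.IsPivotal τ i y) (hm : G.Represents τ i y m a) (hs : (m :: y) <:+ z)
    (hy' : G.IsPivotal τ i y') (hm' : G.Represents τ i y' m' a') (hs' : (m' :: y') <:+ z) :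
    y = y' ∧ m = m' := by
  rcases move_comparable hs hs' with h | h | h
  · exact h
  · exact absurd (hm.isDetermined h) hy'.not_isDetermined
  · exact absurd (hm'.isDetermined h) hy.not_isDetermined

theorem IsPivotal.comparable_opp {i : Fin 2} {y y' z : List M} {m m' : M}
    (hy : G.IsPivotal τ i y) (hs : (m :: y) <:+ z)
    (hy' : G.IsPivotal τ (opp i) y') (hs' : (m' :: y') <:+ z) :
    (m :: y) <:+ y' ∨ (m' :: y') <:+ y := by
  rcases move_comparable hs hs' with h | h
  · have h1 := hy.1.2
    have h2 := hy'.1.2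
    rw [← h.1, h1] at h2
    exact absurd (Option.some.inj h2).symm (opp_ne i)
  · exact h

/-- On a common play one of the two pivotal moves precedes the other. The earlier move settles its
player's action, while a pivotal node always leaves its mover's action open. -/
theorem IsPivotal.isDetermined_iff [∀ i, Nontrivial (A i)] {i : Fin 2} {y y' z : List M}
    {m m' : M} {a : A i} {a' : A (opp i)}
    (hy : G.IsPivotal τ i y) (hm : G.Represents τ i y m a) (hs : (m :: y) <:+ z)
    (hy' : G.IsPivotal τ (opp i) y') (hm' : G.Represents τ (opp i) y' m' a')
    (hs' : (m' :: y') <:+ z) : G.IsDetermined τ (opp i) y ↔ ¬ G.IsDetermined τ i y' := by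
  rcases hy.comparable_opp hs hy' hs' with h | h
  · refine iff_of_false (fun hd => ?_) (fun hd => hd (hm.isDetermined h))
    exact hy'.not_isDetermined (hd.mono ((List.suffix_cons m y).trans h))
  · refine iff_of_true (hm'.isDetermined h) (fun hd => ?_)
    exact hy.not_isDetermined (hd.mono ((List.suffix_cons m' y').trans h))

/-- Along the play that leads to `z`, player `i` makes his choice when the action of his
opponent is still open. -/
def MovesFirst (G : ExtensiveGame M H) (τ : List M → (∀ i, A i)) (i : Fin 2)
    (z : List M) : Prop :=
  ∃ y m, G.IsPivotal τ i y ∧ G.Represents τ i y m (τ z i) ∧ (m :: y) <:+ z ∧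
    ¬ G.IsDetermined τ (opp i) y

theorem IsPivotal.movesFirst_iff [∀ i, Nontrivial (A i)] {i : Fin 2} {y z : List M} {m : M}
    {a : A i} (hz : z ∈ G.terminals) (hy : G.IsPivotal τ i y) (hm : G.Represents τ i y m a)
    (hs : (m :: y) <:+ z) : G.MovesFirst τ i z ↔ ¬ G.IsDetermined τ (opp i) y := by
  constructor
  · rintro ⟨y', m', hy', hm', hs', hd⟩
    rwa [(hy.unique hm hs hy' hm' hs').1]
  · intro hd
    refine ⟨y, m, hy, ?_, hs, hd⟩
    rwa [hm.2.1 z hz hs]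

theorem IsMechanism.movesFirst_opp_iff [∀ i, Nontrivial (A i)] (hG : G.IsMechanism u τ)
    {z : List M} (hz : z ∈ G.terminals) (i : Fin 2) :
    G.MovesFirst τ (opp i) z ↔ ¬ G.MovesFirst τ i z := by
  obtain ⟨y, m, hy, hm, hs⟩ := hG.pivotal z hz i
  obtain ⟨y', m', hy', hm', hs'⟩ := hG.pivotal z hz (opp i)
  rw [hy.movesFirst_iff hz hm hs, hy'.movesFirst_iff hz hm' hs',
    hy.isDetermined_iff hm hs hy' hm' hs', opp_opp, not_not]

theorem IsMechanism.isPivotal_congr (hG : G.IsMechanism u τ) {i : Fin 2} {x y : List M}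
    (hx : G.IsDecision i x) (hxy : G.info i x = G.info i y) (hy : G.IsPivotal τ i y) :
    G.IsPivotal τ i x :=
  ⟨hx, fun a => (hy.2 a).imp fun m hm => (hG.full_disclosure i x y hx hy.1 hxy m a).2 hm⟩

open scoped Classical in
/-- What a deviation to `x'` at the node `y` yields at least to player `i`, if the choices that the
opponent has yet to make yield at least `w`. -/
noncomputable def deviationBound (G : ExtensiveGame M H) (τ : List M → (∀ i, A i))
    (u : Fin 2 → (∀ i, A i) → ℝ) (i : Fin 2) (x' : A i) (w : ℝ) (y : List M) : ℝ :=
  if h : G.IsDetermined τ (opp i) y then u i (pair i x' h.choose) else w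

/-- If the opponent's action is settled at `y`, it is the same after the deviation. Otherwise every
play through the deviation contains a later pivotal move of the opponent, and plays of positive
probability use only his actions in `S`. -/
theorem IsMechanism.deviationBound_le (hG : G.IsMechanism u τ) (hσ : G.IsProfile σ)
    {S : ∀ i, Set (A i)}
    (hS : ∀ i y m a, G.IsPivotal τ i y → G.Represents τ i y m a → 0 < σ y m → a ∈ S i)
    {i : Fin 2} {x' : A i} {w : ℝ} (hw : ∀ b ∈ S (opp i), w ≤ u i (pair i x' b))
    {y : List M} {m : M} (hy : G.IsPivotal τ i y) (hm : G.Represents τ i y m x') :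
    G.deviationBound τ u i x' w y ≤ G.continuation σ (G.payoff i) (m :: y) := by
  refine hσ.le_continuation hm.1 fun z hz hs ht => ?_
  have hx' := hm.2.1 z hz hs
  have hpay : G.payoff i z = u i (pair i x' (τ z (opp i))) := by
    rw [hG.payoff_eq z hz, ← hx', pair_eta]
  rw [hpay, deviationBound]
  split_ifs with hd
  · rw [hd.choose_spec z hz ((List.suffix_cons m y).trans hs)]
  · obtain ⟨y', m', hy', hm', hs'⟩ := hG.pivotal z hz (opp i)
    refine hw _ (hS _ y' m' _ hy' hm' ?_)
    rcases hy.comparable_opp hs hy' hs' with h | h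
    · rw [transition_mul σ (h.trans (List.suffix_cons m' y')) hs',
        transition_mul σ h (List.suffix_cons m' y'), transition_cons σ (by simp),
        transition_self, one_mul] at ht
      exact lt_of_le_of_ne (hσ.nonneg hy'.1.1 m')
        (right_ne_zero_of_mul (left_ne_zero_of_mul ht)).symm
    · exact absurd (hm'.isDetermined h) hd

/-- Sequential rationality multiplied by the probability of the information set and of `m`, which
turns beliefs into reach probabilities. Full disclosure makes the same deviating move available,
with the same meaning, at all nodes of the information set. -/
theorem IsMechanism.infoSet_incentive (hG : G.IsMechanism u τ)
    (hE : G.IsSequentialEquilibrium ψ σ) {S : ∀ i, Set (A i)}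
    (hS : ∀ i y m a, G.IsPivotal τ i y → G.Represents τ i y m a → 0 < σ y m → a ∈ S i)
    {i : Fin 2} {x' : A i} {w : ℝ} (hw : ∀ b ∈ S (opp i), w ≤ u i (pair i x' b))
    {y : List M} {m : M} (hy : G.IsPivotal τ i y) (hm : m :: y ∈ G.nodes) :
    0 ≤ ∑ x ∈ G.infoSet i y, reach σ x * σ x m *
      (G.continuation σ (G.payoff i) (m :: x) - G.deviationBound τ u i x' w x) := by
  have hdec : ∀ x ∈ G.infoSet i y, G.IsDecision i x ∧ G.info i x = G.info i y :=
    fun x hx => G.mem_infoSet.1 hx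
  set R := ∑ x ∈ G.infoSet i y, reach σ x with hR
  have hR0 : 0 ≤ R := Finset.sum_nonneg fun x hx => hE.profile.reach_nonneg (hdec x hx).1.1.1
  have heq : ∀ x ∈ G.infoSet i y, reach σ x * σ x m *
      (G.continuation σ (G.payoff i) (m :: x) - G.deviationBound τ u i x' w x) =
      R * σ y m * (ψ x * (G.continuation σ (G.payoff i) (m :: x) -
        G.deviationBound τ u i x' w x)) := by
    intro x hx
    have h1 := hE.consistent.belief_mul_reach (hdec x hx).1
    rw [G.infoSet_congr (hdec x hx).2, ← hR] at h1
    rw [← h1, hE.profile.info_const i x y (hdec x hx).1 hy.1 (hdec x hx).2]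
    ring
  rw [Finset.sum_congr rfl heq, ← Finset.mul_sum]
  rcases (hE.profile.nonneg hy.1.1 m).eq_or_lt with h0 | h0
  · simp [← h0]
  refine mul_nonneg (mul_nonneg hR0 h0.le) ?_
  obtain ⟨m', hm'⟩ := hy.2 x'
  have hr := hE.rational i y hy.1 m m' hm hm'.1 h0
  rw [moveValue_eq, moveValue_eq] at hr
  simp only [mul_sub, Finset.sum_sub_distrib]
  refine sub_nonneg.2 (le_trans (Finset.sum_le_sum fun x hx => ?_) hr)
  refine mul_le_mul_of_nonneg_left ?_ (hE.consistent.belief_nonneg (hdec x hx).1)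
  exact hG.deviationBound_le hE.profile hS hw (hG.isPivotal_congr (hdec x hx).1 (hdec x hx).2 hy)
    ((hG.full_disclosure i x y (hdec x hx).1 hy.1 (hdec x hx).2 m' x').2 hm')

-- Each play with `τ z i = x` passes through exactly one pivotal move representing `x`, so the sum
-- over terminal nodes is a sum over such moves. Grouping these by move and information set reduces
-- the claim to `infoSet_incentive`.
open scoped Classical in
theorem IsMechanism.sum_terminals_incentive [∀ i, Nontrivial (A i)] (hG : G.IsMechanism u τ)
    (hE : G.IsSequentialEquilibrium ψ σ) {S : ∀ i, Set (A i)}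
    (hS : ∀ i y m a, G.IsPivotal τ i y → G.Represents τ i y m a → 0 < σ y m → a ∈ S i)
    {i : Fin 2} (x : A i) {x' : A i} {w : ℝ} (hw : ∀ b ∈ S (opp i), w ≤ u i (pair i x' b)) :
    0 ≤ ∑ z ∈ G.terminals, if τ z i = x then reach σ z * (u i (τ z) -
      if G.MovesFirst τ i z then w else u i (pair i x' (τ z (opp i)))) else 0 := by
  set h : List M → ℝ := fun z => reach σ z * (u i (τ z) -
      if G.MovesFirst τ i z then w else u i (pair i x' (τ z (opp i)))) with hh
  set P : Finset (M × List M) := (Finset.univ ×ˢ G.nodes).filter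
    fun p => G.IsPivotal τ i p.2 ∧ G.Represents τ i p.2 p.1 x with hP
  have memP : ∀ {p}, p ∈ P ↔ G.IsPivotal τ i p.2 ∧ G.Represents τ i p.2 p.1 x := by
    intro p
    simp only [hP, Finset.mem_filter, Finset.mem_product, Finset.mem_univ, true_and,
      and_iff_right_iff_imp]
    exact fun hp => hp.1.1.1.1
  have step1 : ∀ z ∈ G.terminals, (if τ z i = x then h z else 0) =
      ∑ p ∈ P, if (p.1 :: p.2) <:+ z then h z else 0 := by
    intro z hz
    by_cases hx : τ z i = x
    · obtain ⟨y, m, hy, hm, hs⟩ := hG.pivotal z hz i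
      rw [hx] at hm
      rw [if_pos hx, Finset.sum_eq_single_of_mem (m, y) (memP.2 ⟨hy, hm⟩), if_pos hs]
      rintro ⟨m', y'⟩ hp hne
      refine if_neg fun hs' => hne ?_
      obtain ⟨rfl, rfl⟩ := hy.unique hm hs (memP.1 hp).1 (memP.1 hp).2 hs'
      rfl
    · rw [if_neg hx, Finset.sum_eq_zero]
      intro p hp
      exact if_neg fun hs => hx ((memP.1 hp).2.2.1 z hz hs)
  have step2 : ∀ p ∈ P, (∑ z ∈ G.terminals, if (p.1 :: p.2) <:+ z then h z else 0) =
      reach σ p.2 * σ p.2 p.1 * (G.continuation σ (G.payoff i) (p.1 :: p.2) -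
        G.deviationBound τ u i x' w p.2) := by
    rintro ⟨m, y⟩ hp
    obtain ⟨hy, hm⟩ := memP.1 hp
    have h1 := hE.profile.continuation_one _ hm.1
    rw [← mul_one (G.deviationBound τ u i x' w y), ← h1, ← reach_cons]
    simp only [continuation, mul_one, Finset.mul_sum, ← Finset.sum_sub_distrib]
    refine Finset.sum_congr rfl fun z hz => ?_
    split_ifs with hs
    · have hb : (if G.MovesFirst τ i z then w else u i (pair i x' (τ z (opp i)))) =
          G.deviationBound τ u i x' w y := by
        rw [deviationBound]
        by_cases hd : G.IsDetermined τ (opp i) y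
        · rw [if_neg ((hy.movesFirst_iff hz hm hs).not.2 (not_not.2 hd)), dif_pos hd,
            hd.choose_spec z hz ((List.suffix_cons m y).trans hs)]
        · rw [if_pos ((hy.movesFirst_iff hz hm hs).2 hd), dif_neg hd]
      simp only [hh]
      rw [hb, reach_mul σ hs, hG.payoff_eq z hz]
      ring
    · rw [transition_eq_zero hs]
      ring
  rw [Finset.sum_congr rfl step1, Finset.sum_comm, Finset.sum_congr rfl step2]
  refine sum_nonneg_of_fiberwise P (fun p => (p.1, G.info i p.2)) _ ?_
  rintro ⟨m, y⟩ hp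
  obtain ⟨hy, hm⟩ := memP.1 hp
  have hfib : (P.filter fun q => (q.1, G.info i q.2) = (m, G.info i y)) =
      (G.infoSet i y).image fun x => (m, x) := by
    ext ⟨m', y'⟩
    simp only [Finset.mem_filter, memP, Prod.mk.injEq, Finset.mem_image, G.mem_infoSet]
    constructor
    · rintro ⟨⟨h1, h2⟩, rfl, h3⟩
      exact ⟨y', ⟨h1.1, h3⟩, rfl, rfl⟩
    · rintro ⟨y'', ⟨h1, h2⟩, rfl, rfl⟩
      exact ⟨⟨hG.isPivotal_congr h1 h2 hy,
        (hG.full_disclosure i y'' y h1 hy.1 h2 m x).2 hm⟩, rfl, h2⟩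
  rw [hfib, Finset.sum_image fun _ _ _ _ h => (Prod.mk.inj h).2]
  exact hG.infoSet_incentive hE hS hw hy hm.1

/-- The outcome of a sequential equilibrium in which only actions in `S` are chosen at pivotal
nodes satisfies the incentive constraints with threats in `S`. -/
theorem IsMechanism.exists_incentiveCompatible [∀ i, Nontrivial (A i)] [∀ i, Fintype (A i)]
    (hG : G.IsMechanism u τ) (hE : G.IsSequentialEquilibrium ψ σ) (S : ∀ i, Set (A i))
    (hS : ∀ i y m a, G.IsPivotal τ i y → G.Represents τ i y m a → 0 < σ y m → a ∈ S i)
    {α : (∀ i, A i) → ℝ}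
    (hα : ∀ a, α a = open scoped Classical in
      ∑ z ∈ G.terminals, if τ z = a then reach σ z else 0) :
    ∃ θ : (∀ i, A i) → Fin 2 → ℝ, (∀ a, θ a ∈ stdSimplex ℝ (Fin 2)) ∧
      ∀ (i : Fin 2) (x x' : A i) (w : ℝ), (∀ b ∈ S (opp i), w ≤ u i (pair i x' b)) →
        0 ≤ ∑ y, α (pair i x y) * (u i (pair i x y)
          - (1 - θ (pair i x y) i) * u i (pair i x' y) - θ (pair i x y) i * w) := by
  classical
  set Q : (∀ i, A i) → Fin 2 → ℝ := fun a i =>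
    ∑ z ∈ G.terminals, if τ z = a ∧ G.MovesFirst τ i z then reach σ z else 0 with hQ
  have hr : ∀ z ∈ G.terminals, 0 ≤ reach σ z :=
    fun z hz => hE.profile.reach_nonneg (G.mem_terminals.1 hz).1
  have hQ0 : ∀ a i, 0 ≤ Q a i := fun a i => Finset.sum_nonneg fun z hz => by
    split_ifs
    exacts [hr z hz, le_rfl]
  have hQα : ∀ a i, Q a i + Q a (opp i) = α a := by
    intro a i
    simp only [hQ, hα]
    rw [← Finset.sum_add_distrib]
    refine Finset.sum_congr rfl fun z hz => ?_
    rw [hG.movesFirst_opp_iff hz i]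
    by_cases h1 : τ z = a <;> by_cases h2 : G.MovesFirst τ i z <;> simp [h1, h2]
  -- The conditional probability of moving first given the outcome; the value `1 / 2` at outcomes of
  -- probability zero is arbitrary.
  set θ : (∀ i, A i) → Fin 2 → ℝ := fun a i => if α a = 0 then 1 / 2 else Q a i / α a with hθ
  have hθQ : ∀ a i, α a * θ a i = Q a i := by
    intro a i
    simp only [hθ]
    split_ifs with h
    · linarith [hQ0 a i, hQ0 a (opp i), hQα a i]
    · rw [mul_div_cancel₀ _ h]
  refine ⟨θ, fun a => ⟨fun i => ?_, ?_⟩, fun i x x' w hw => ?_⟩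
  · simp only [hθ]
    split_ifs
    · norm_num
    · refine div_nonneg (hQ0 a i) ?_
      linarith [hQ0 a i, hQ0 a (opp i), hQα a i]
  · rw [sum_player 0]
    simp only [hθ]
    split_ifs with h
    · norm_num
    · rw [← add_div, hQα, div_self h]
  · refine (hG.sum_terminals_incentive hE hS x hw).trans_eq ?_
    have key : ∀ y, α (pair i x y) * (u i (pair i x y)
        - (1 - θ (pair i x y) i) * u i (pair i x' y) - θ (pair i x y) i * w) =
        ∑ z ∈ G.terminals, if τ z = pair i x y then reach σ z * (u i (τ z) -
          if G.MovesFirst τ i z then w else u i (pair i x' (τ z (opp i)))) else 0 := by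
      intro y
      have e1 : α (pair i x y) * (u i (pair i x y)
          - (1 - θ (pair i x y) i) * u i (pair i x' y) - θ (pair i x y) i * w) =
          α (pair i x y) * (u i (pair i x y) - u i (pair i x' y)) +
            α (pair i x y) * θ (pair i x y) i * (u i (pair i x' y) - w) := by ring
      rw [e1, hθQ, hα, hQ, Finset.sum_mul, Finset.sum_mul, ← Finset.sum_add_distrib]
      refine Finset.sum_congr rfl fun z _ => ?_
      by_cases h1 : τ z = pair i x y <;> by_cases h2 : G.MovesFirst τ i z <;>
        (simp [h1, h2]; try ring)
    simp only [key]
    rw [Finset.sum_comm]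
    refine Finset.sum_congr rfl fun z _ => ?_
    by_cases hx : τ z i = x
    · have hz : τ z = pair i x (τ z (opp i)) := by rw [← hx, pair_eta]
      rw [if_pos hx, Finset.sum_eq_single_of_mem (τ z (opp i)) (Finset.mem_univ _), if_pos hz]
      intro b _ hb
      refine if_neg fun h => hb ?_
      rw [h, pair_opp]
    · rw [if_neg hx, Finset.sum_eq_zero]
      intro b _
      refine if_neg fun h => hx ?_
      rw [h, pair_self]

end Mechanism

end ExtensiveGame

end InterdependentChoice

/-! ### Absolute domination and pure Nash equilibria. -/

namespace InterdependentChoice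

variable {A : Fin 2 → Type*} {u : Fin 2 → (∀ i, A i) → ℝ}

/-- The action profile `a` is a Nash equilibrium in pure strategies. -/
def IsPureNash (u : Fin 2 → (∀ i, A i) → ℝ) (a : ∀ i, A i) : Prop :=
  ∀ i b, b (opp i) = a (opp i) → u i b ≤ u i a

/-- The action `d` of player `i` always does worse than `d'`, whatever the opponent plays against
each of the two actions. -/
def IsAbsolutelyDominated (u : Fin 2 → (∀ i, A i) → ℝ) (i : Fin 2) (d d' : A i) : Prop :=
  ∀ y y', u i (pair i d y) < u i (pair i d' y')

theorem IsAbsolutelyDominated.ne [∀ i, Nonempty (A i)] {i : Fin 2} {d d' : A i}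
    (h : IsAbsolutelyDominated u i d d') : d ≠ d' := by
  rintro rfl
  obtain ⟨y⟩ := ‹∀ i, Nonempty (A i)› (opp i)
  exact lt_irrefl _ (h y y)

theorem le_worstPayoff {i : Fin 2} {x : A i} {S : Set (A (opp i))} (hS : S.Nonempty) {w : ℝ}
    (h : ∀ y ∈ S, w ≤ u i (pair i x y)) : w ≤ worstPayoff u i x S :=
  le_csInf (hS.image _) (by rintro _ ⟨y, hy, rfl⟩; exact h y hy)

variable [∀ i, Fintype (A i)]

theorem exists_separation [∀ i, Nonempty (A i)] {i : Fin 2} {d d' : A i}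
    (h : IsAbsolutelyDominated u i d d') :
    ∃ C c : ℝ, C < c ∧ (∀ y, u i (pair i d y) ≤ C) ∧ ∀ y, c ≤ u i (pair i d' y) := by
  obtain ⟨y, hy⟩ := Finite.exists_max fun y => u i (pair i d y)
  obtain ⟨y', hy'⟩ := Finite.exists_min fun y => u i (pair i d' y)
  exact ⟨_, _, h y y', hy, hy'⟩

section Weights

variable {α : (∀ i, A i) → ℝ}

theorem sum_pair_eq_sum_ite [∀ i, DecidableEq (A i)] (i : Fin 2) (x : A i)
    (f : (∀ j, A j) → ℝ) : ∑ y, f (pair i x y) = ∑ a, if a i = x then f a else 0 := by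
  rw [sum_pair i, Finset.sum_eq_single_of_mem x (Finset.mem_univ _)]
  · simp
  · intro x' _ hx'
    simp [hx']

theorem marginal_pos (h0 : ∀ a, 0 ≤ α a) {a : ∀ i, A i} (ha : 0 < α a) (i : Fin 2) :
    0 < marginal α i (a i) := by
  rw [← pair_eta i a] at ha
  exact ha.trans_le (Finset.single_le_sum (f := fun y => α (pair i (a i) y))
    (fun y _ => h0 _) (Finset.mem_univ (a (opp i))))

theorem exists_pos_of_mem_stdSimplex {ι : Type*} [Fintype ι] {p : ι → ℝ}
    (hp : p ∈ stdSimplex ℝ ι) : ∃ a, 0 < p a := by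
  by_contra! h
  have := Finset.sum_nonpos fun a (_ : a ∈ Finset.univ) => h a
  rw [hp.2] at this
  linarith

theorem worstPayoff_le {i : Fin 2} {x : A i} {S : Set (A (opp i))} {y : A (opp i)} (hy : y ∈ S) :
    worstPayoff u i x S ≤ u i (pair i x y) :=
  csInf_le (Set.toFinite _).bddBelow (Set.mem_image_of_mem _ hy)

theorem effectiveThreats_nonempty (hα : α ∈ stdSimplex ℝ (∀ i, A i)) (B : ∀ i, Set (A i))
    (i : Fin 2) : (effectiveThreats α B i).Nonempty := by
  obtain ⟨a, ha⟩ := exists_pos_of_mem_stdSimplex hα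
  exact ⟨a i, .inr (marginal_pos hα.1 ha i).ne'⟩

/-- Any `θ` works: the opponent's equilibrium action lies in the support and is thus itself a
threat, so the worst payoff of a deviation is at most its payoff against that action. -/
theorem isICE_of_isPureNash (B : ∀ i, Set (A i)) (hα : α ∈ stdSimplex ℝ (∀ i, A i))
    {a : ∀ i, A i} (ha : ∀ b, b ≠ a → α b = 0) (hn : IsPureNash u a) : IsICE u B α := by
  refine ⟨hα, fun _ _ => 1 / 2, fun _ => ⟨fun _ => by norm_num, ?_⟩, fun i x x' => ?_⟩
  · rw [sum_player 0]
    norm_num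
  refine Finset.sum_nonneg fun y _ => ?_
  by_cases h : pair i x y = a
  · rcases (hα.1 (pair i x y)).eq_or_lt with h0 | h0
    · simp [← h0]
    refine mul_nonneg h0.le ?_
    have h1 : u i (pair i x' y) ≤ u i (pair i x y) := by
      rw [h]
      exact hn i _ (by simp [← h])
    have h2 : worstPayoff u i x' (effectiveThreats α B (opp i)) ≤ u i (pair i x' y) := by
      refine worstPayoff_le (.inr ?_)
      have := marginal_pos hα.1 h0 (opp i)
      rw [pair_opp] at this
      exact this.ne'
    linarith
  · simp [ha _ h]

end Weights

/-- The incentive constraint of a mediated mechanism for the deviation of `i` from `x` to `x'`, if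
the deviator is punished with the payoff `w`. -/
def Incentives (u : Fin 2 → (∀ i, A i) → ℝ) (α : (∀ i, A i) → ℝ) (θ : (∀ i, A i) → Fin 2 → ℝ)
    (i : Fin 2) (x x' : A i) (w : ℝ) : Prop :=
  0 ≤ ∑ y : A (opp i), α (pair i x y) * (u i (pair i x y)
    - (1 - θ (pair i x y) i) * u i (pair i x' y) - θ (pair i x y) i * w)

section Incentives

variable {α : (∀ i, A i) → ℝ} {θ : (∀ i, A i) → Fin 2 → ℝ}

/-- A harsher punishment only relaxes the constraint. -/
theorem Incentives.anti (h0 : ∀ a, 0 ≤ α a) (hθ : ∀ a i, 0 ≤ θ a i) {i : Fin 2} {x x' : A i}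
    {w w' : ℝ} (hw : w' ≤ w) (h : Incentives u α θ i x x' w) : Incentives u α θ i x x' w' :=
  le_trans h (Finset.sum_le_sum fun _ _ => mul_le_mul_of_nonneg_left
    (sub_le_sub_left (mul_le_mul_of_nonneg_left hw (hθ _ _)) _) (h0 _))

theorem le_one_of_mem_stdSimplex {p : Fin 2 → ℝ} (hp : p ∈ stdSimplex ℝ (Fin 2)) (i : Fin 2) :
    p i ≤ 1 := by
  have := hp.2
  rw [sum_player i] at this
  linarith [hp.1 (opp i)]

/-- Both parts of the deviation payoff are at least `c`, and obedience yields at most `C < c`. Every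
bracket in the constraint is therefore negative and can only carry weight zero. -/
theorem eq_zero_of_isAbsolutelyDominated [∀ i, Nonempty (A i)] (h0 : ∀ a, 0 ≤ α a)
    (hθ : ∀ a, θ a ∈ stdSimplex ℝ (Fin 2)) {i : Fin 2} {d d' : A i}
    (hd : IsAbsolutelyDominated u i d d')
    (h : ∀ w, (∀ y, w ≤ u i (pair i d' y)) → Incentives u α θ i d d' w)
    {a : ∀ i, A i} (ha : a i = d) : α a = 0 := by
  obtain ⟨C, c, hCc, hC, hc⟩ := exists_separation hd
  have hpos : ∀ y, 0 < -(u i (pair i d y) - (1 - θ (pair i d y) i) * u i (pair i d' y) -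
      θ (pair i d y) i * c) := by
    intro y
    have h1 := (hθ (pair i d y)).1 i
    have h2 := le_one_of_mem_stdSimplex (hθ (pair i d y)) i
    have h3 := mul_le_mul_of_nonneg_left (hc y) (sub_nonneg.2 h2)
    linarith [hC y]
  have h1 : ∑ y, α (pair i d y) * -(u i (pair i d y) -
      (1 - θ (pair i d y) i) * u i (pair i d' y) - θ (pair i d y) i * c) = 0 := by
    refine le_antisymm ?_ (Finset.sum_nonneg fun y _ => mul_nonneg (h0 _) (hpos y).le)
    simp only [mul_neg, Finset.sum_neg_distrib]
    exact neg_nonpos.2 (h c hc)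
  have h2 := (Finset.sum_eq_zero_iff_of_nonneg fun y _ => mul_nonneg (h0 _) (hpos y).le).1 h1
    (a (opp i)) (Finset.mem_univ _)
  have h3 := (mul_eq_zero.1 h2).resolve_right (hpos _).ne'
  rwa [← ha, pair_eta] at h3

/-- Given the opponent's action, only one profile in the support remains, so his constraint has a
single term. Player `i` uses `d'` both on the path and as a threat, so `θ` drops out and the
constraint is the best-response condition against `d'`. Injectivity of payoffs makes the best
response unique. -/
theorem exists_isPureNash_of_isAbsolutelyDominated [∀ i, Nonempty (A i)]
    (hu : NoRepeatedPayoffs u) (hα : α ∈ stdSimplex ℝ (∀ i, A i)) {i : Fin 2} {d d' : A i}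
    (hA : ∀ x : A i, x = d ∨ x = d') (hd : IsAbsolutelyDominated u i d d')
    (h1 : ∀ a, a i = d → α a = 0)
    (h2 : ∀ x x' w, (∀ a : ∀ j, A j, a i = d' → a (opp i) = x' → w ≤ u (opp i) a) →
      Incentives u α θ (opp i) x x' w) :
    ∃ a, IsPureNash u a ∧ ∀ b, b ≠ a → α b = 0 := by
  classical
  have hd' : ∀ a, 0 < α a → a i = d' := fun a ha => (hA (a i)).resolve_left
    fun h => ha.ne' (h1 a h)
  have key : ∀ a, 0 < α a → ∀ b : ∀ j, A j, b i = d' → u (opp i) b ≤ u (opp i) a := by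
    intro a ha b hb
    have hb' : b = pair i d' (b (opp i)) := profile_ext i (by simp [hb]) (by simp)
    have h := h2 (a (opp i)) (b (opp i)) (u (opp i) b) fun c hc hc' =>
      (congrArg (u (opp i)) (profile_ext i (by rw [hb, hc]) hc'.symm)).le
    unfold Incentives at h
    have hs := sum_pair_eq_sum_ite (opp i) (a (opp i)) fun c => α c * (u (opp i) c
      - (1 - θ c (opp i)) * u (opp i) (pair (opp i) (b (opp i)) (c (opp (opp i))))
      - θ c (opp i) * u (opp i) b)
    simp only [pair_opp] at hs
    rw [hs, Finset.sum_eq_single_of_mem a (Finset.mem_univ _), if_pos rfl] at h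
    · have hab : pair (opp i) (b (opp i)) (a (opp (opp i))) = b := by
        refine profile_ext (opp i) (by simp) ?_
        -- The equation `opp (opp i) = i` is not definitional, so the index is generalized before
        -- substituting.
        have : ∀ j, j = i → a j = b j := by
          rintro _ rfl
          rw [hd' a ha, hb]
        rw [pair_opp]
        exact this _ (opp_opp i)
      rw [hab] at h
      have := nonneg_of_mul_nonneg_right h ha
      linarith
    · intro c _ hca
      split_ifs with hc
      · rw [h1 c, zero_mul]
        refine (hA (c i)).resolve_right fun hc' => hca (profile_ext i ?_ hc)
        rw [hc', hd' a ha]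
      · rfl
  obtain ⟨a, ha⟩ := exists_pos_of_mem_stdSimplex hα
  refine ⟨a, (forall_player i).2 ⟨fun b hb => ?_, fun b hb => key a ha b ?_⟩, fun b hba => ?_⟩
  · rcases hA (b i) with h | h
    · have := hd (b (opp i)) (a (opp i))
      rw [← h, ← hd' a ha, pair_eta, pair_eta] at this
      exact this.le
    · exact (congrArg (u i) (profile_ext i (by rw [h, hd' a ha]) hb)).le
  · rw [opp_opp] at hb
    rw [hb, hd' a ha]
  · by_contra hb
    have hb0 := lt_of_le_of_ne (hα.1 b) (Ne.symm hb)
    exact hba (hu (opp i) (le_antisymm (key a ha b (hd' b hb0)) (key b hb0 a (hd' a ha))))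

end Incentives

theorem sum_mul_le_of_mem_stdSimplex {ι : Type*} [Fintype ι] {p f : ι → ℝ}
    (hp : p ∈ stdSimplex ℝ ι) {C : ℝ} (h : ∀ y, f y ≤ C) : ∑ y, f y * p y ≤ C :=
  (Finset.sum_le_sum fun y _ => mul_le_mul_of_nonneg_right (h y) (hp.1 y)).trans_eq
    (by rw [← Finset.mul_sum, hp.2, mul_one])

theorem le_sum_mul_of_mem_stdSimplex {ι : Type*} [Fintype ι] {p f : ι → ℝ}
    (hp : p ∈ stdSimplex ℝ ι) {c : ℝ} (h : ∀ y, c ≤ f y) : c ≤ ∑ y, f y * p y :=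
  le_of_eq_of_le (by rw [← Finset.mul_sum, hp.2, mul_one])
    (Finset.sum_le_sum fun y _ => mul_le_mul_of_nonneg_right (h y) (hp.1 y))

/-- Under any beliefs, `d` earns at most `C` and `d'` at least `c > C`. -/
theorem notMem_cRationalizable [∀ i, Nonempty (A i)] {i : Fin 2} {d d' : A i}
    (hd : IsAbsolutelyDominated u i d d') : d ∉ cRationalizable u i := by
  rintro ⟨A', hA', hdA⟩
  obtain ⟨l, hl, hmax⟩ := hA' i hdA
  obtain ⟨C, c, hCc, hC, hc⟩ := exists_separation hd
  have h1 := sum_mul_le_of_mem_stdSimplex (hl d).1 hC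
  have h2 := le_sum_mul_of_mem_stdSimplex (hl d').1 hc
  have h3 := hmax d'
  unfold expectedUtility at h3
  linarith

theorem cRationalizable_eq_univ [∀ i, Nonempty (A i)]
    (h : ∀ i d d', ¬ IsAbsolutelyDominated u i d d') (i : Fin 2) :
    cRationalizable u i = Set.univ := by
  classical
  refine Set.eq_univ_of_forall fun x => ⟨fun _ => Set.univ, fun i x _ => ?_, Set.mem_univ x⟩
  obtain ⟨y, hy⟩ := Finite.exists_max fun y => u i (pair i x y)
  have hx : ∀ x', ∃ y', u i (pair i x' y') ≤ u i (pair i x y) := by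
    intro x'
    by_contra! hc
    exact h i x x' fun z z' => (hy z).trans_lt (hc z')
  choose f hf using hx
  -- Belief in the most favourable reply `y` to `x`, and in a reply `f x'` to each other `x'` that
  -- makes it no better.
  refine ⟨fun x' => Pi.single (if x' = x then y else f x') 1,
    fun x' => ⟨single_mem_stdSimplex ℝ _, fun z hz => absurd (Set.mem_univ z) hz⟩, fun x' => ?_⟩
  simp only [expectedUtility, Pi.single_apply, mul_ite, mul_one, mul_zero,
    Finset.sum_ite_eq', Finset.mem_univ, if_true]
  split_ifs with hx'
  · rw [hx']
  · exact hf x'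

/-- The action `d` is neither C-rationalizable nor in the support of the marginal, so the effective
threats of `i` reduce to `d'`. -/
theorem IsICE.exists_isPureNash [∀ i, Nonempty (A i)] {α : (∀ i, A i) → ℝ}
    (hu : NoRepeatedPayoffs u) {i : Fin 2} {d d' : A i}
    (hA : ∀ x : A i, x = d ∨ x = d') (hd : IsAbsolutelyDominated u i d d')
    (h : IsICE u (cRationalizable u) α) :
    ∃ a, IsPureNash u a ∧ ∀ b, b ≠ a → α b = 0 := by
  obtain ⟨hα, θ, hθ, hic⟩ := h
  have h1 : ∀ a : ∀ i, A i, a i = d → α a = 0 := fun a ha => by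
    refine eq_zero_of_isAbsolutelyDominated hα.1 hθ hd (fun w hw => ?_) ha
    exact Incentives.anti hα.1 (fun a => (hθ a).1)
      (le_worstPayoff (effectiveThreats_nonempty hα _ _) fun y _ => hw y) (hic i d d')
  have h3 : ∀ a : ∀ i, A i, a i ∈ effectiveThreats α (cRationalizable u) i → a i = d' := by
    intro a ha
    refine (hA (a i)).resolve_left fun had => ?_
    rw [had] at ha
    refine ha.elim (notMem_cRationalizable hd) fun hm => hm ?_
    exact Finset.sum_eq_zero fun y _ => h1 _ (pair_self _ _ _)
  refine exists_isPureNash_of_isAbsolutelyDominated hu hα hA hd h1 (θ := θ) fun x x' w hw => ?_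
  refine Incentives.anti hα.1 (fun a => (hθ a).1)
    (le_worstPayoff (effectiveThreats_nonempty hα _ _) fun y hy => ?_) (hic (opp i) x x')
  refine hw _ (h3 _ ?_) (pair_self _ _ _)
  have : ∀ j, j = opp (opp i) → pair (opp i) x' y j ∈ effectiveThreats α (cRationalizable u) j := by
    rintro _ rfl
    simpa using hy
  exact this i (opp_opp i).symm

namespace ExtensiveGame

variable {M H : Type} [Fintype M] {G : ExtensiveGame M H} {σ : List M → M → ℝ} {ψ : List M → ℝ}
  {τ : List M → (∀ i, A i)}

/-- Beliefs sum to one at every information set, so the separation of the payoffs from `d` and `d'`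
passes to the values of the moves. This covers pivotal nodes off the path, where threats are carried
out. -/
theorem IsMechanism.not_chosen_of_isAbsolutelyDominated [∀ i, Nonempty (A i)]
    (hG : G.IsMechanism u τ) (hE : G.IsSequentialEquilibrium ψ σ) {i : Fin 2} {d d' : A i}
    (hd : IsAbsolutelyDominated u i d d') {y : List M} {m : M} (hy : G.IsPivotal τ i y)
    (hm : G.Represents τ i y m d) : ¬ 0 < σ y m := by
  intro hpos
  obtain ⟨C, c, hCc, hC, hc⟩ := exists_separation hd
  obtain ⟨m', hm'⟩ := hy.2 d'
  have hr := hE.rational i y hy.1 m m' hm.1 hm'.1 hpos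
  rw [moveValue_eq, moveValue_eq] at hr
  have hs := hE.consistent.sum_belief hy.1
  have hpay : ∀ z ∈ G.terminals, G.payoff i z = u i (pair i (τ z i) (τ z (opp i))) := by
    intro z hz
    rw [hG.payoff_eq z hz, pair_eta]
  have h1 : ∑ x ∈ G.infoSet i y, ψ x * G.continuation σ (G.payoff i) (m :: x) ≤ C := by
    rw [← one_mul C, ← hs, Finset.sum_mul]
    refine Finset.sum_le_sum fun x hx => ?_
    obtain ⟨hx1, hx2⟩ := G.mem_infoSet.1 hx
    have hmx := (hG.full_disclosure i x y hx1 hy.1 hx2 m d).2 hm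
    refine mul_le_mul_of_nonneg_left ?_ (hE.consistent.belief_nonneg hx1)
    refine hE.profile.continuation_le hmx.1 fun z hz hzs _ => ?_
    rw [hpay z hz, hmx.2.1 z hz hzs]
    exact hC _
  have h2 : c ≤ ∑ x ∈ G.infoSet i y, ψ x * G.continuation σ (G.payoff i) (m' :: x) := by
    rw [← one_mul c, ← hs, Finset.sum_mul]
    refine Finset.sum_le_sum fun x hx => ?_
    obtain ⟨hx1, hx2⟩ := G.mem_infoSet.1 hx
    have hmx := (hG.full_disclosure i x y hx1 hy.1 hx2 m' d').2 hm'
    refine mul_le_mul_of_nonneg_left ?_ (hE.consistent.belief_nonneg hx1)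
    refine hE.profile.le_continuation hmx.1 fun z hz hzs _ => ?_
    rw [hpay z hz, hmx.2.1 z hz hzs]
    exact hc _
  linarith

end ExtensiveGame

theorem SequentiallyImplementable.exists_isPureNash [∀ i, Nontrivial (A i)]
    {α : (∀ i, A i) → ℝ} (hα : α ∈ stdSimplex ℝ (∀ i, A i))
    (hu : NoRepeatedPayoffs u) {i : Fin 2} {d d' : A i}
    (hA : ∀ x : A i, x = d ∨ x = d') (hd : IsAbsolutelyDominated u i d d')
    (h : SequentiallyImplementable u α) :
    ∃ a, IsPureNash u a ∧ ∀ b, b ≠ a → α b = 0 := by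
  obtain ⟨M, H, _, G, τ, ψ, σ, hG, hE, hout⟩ := h
  obtain ⟨θ, hθ, hic⟩ := hG.exists_incentiveCompatible hE
    -- All actions, except that `d` is removed for player `i`; the transport identifies the types of
    -- `x` and `d`.
    (fun j => {x | ∀ h : j = i, x ≠ h.symm ▸ d}) (by
      rintro j y m x hy hm hpos rfl rfl
      exact hG.not_chosen_of_isAbsolutelyDominated hE hd hy hm hpos) hout
  have h1 : ∀ a : ∀ i, A i, a i = d → α a = 0 := fun a ha =>
    eq_zero_of_isAbsolutelyDominated hα.1 hθ hd (fun w hw => hic i d d' w fun y _ => hw y) ha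
  refine exists_isPureNash_of_isAbsolutelyDominated hu hα hA hd h1 (θ := θ) fun x x' w hw => ?_
  refine hic (opp i) x x' w fun y hy => hw _ ?_ (pair_self _ _ _)
  have : ∀ j, j = opp (opp i) → ∀ h : j = i, pair (opp i) x' y j ≠ h.symm ▸ d := by
    rintro _ rfl
    rw [pair_opp]
    exact hy
  exact (hA _).resolve_left (this i (opp_opp i).symm rfl)

theorem SequentiallyImplementable.isICE [∀ i, Nontrivial (A i)] {α : (∀ i, A i) → ℝ}
    (hα : α ∈ stdSimplex ℝ (∀ i, A i)) (h : SequentiallyImplementable u α) :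
    IsICE u (fun _ => Set.univ) α := by
  obtain ⟨M, H, _, G, τ, ψ, σ, hG, hE, hout⟩ := h
  obtain ⟨θ, hθ, hic⟩ := hG.exists_incentiveCompatible hE (fun _ => Set.univ)
    (fun _ _ _ _ _ _ _ => Set.mem_univ _) hout
  exact ⟨hα, θ, hθ, fun i x x' => hic i x x' _ fun y _ => worstPayoff_le (.inl (Set.mem_univ y))⟩

end InterdependentChoice

/-! ### Sequential equilibria from rescaled reach probabilities. -/

namespace InterdependentChoice

open Filter Topology

namespace ExtensiveGame

variable {M H : Type} [Fintype M] {G : ExtensiveGame M H} {σ : List M → M → ℝ}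

/-- A strategy profile is part of a sequential equilibrium if it is approximated by strictly mixed
profiles such that at every information set, after rescaling, the probabilities of reaching its
nodes converge to weights `L` against which `σ` is optimal. -/
theorem exists_isSequentialEquilibrium (hσ : G.IsProfile σ)
    (hnat : ∀ x, G.IsInner x → G.mover x = none → σ x = G.chance x)
    {σs : ℕ → List M → M → ℝ} (hp : ∀ n, G.IsProfile (σs n))
    (hmix : ∀ n, G.IsStrictlyMixed (σs n))
    (hlim : ∀ x, G.IsInner x → ∀ m, Tendsto (fun n => σs n x m) atTop (𝓝 (σ x m)))
    (hbel : ∀ j y, G.IsDecision j y → ∃ (s : ℕ → ℝ) (L : List M → ℝ), (∀ n, 0 < s n) ∧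
      (∀ x ∈ G.infoSet j y, Tendsto (fun n => reach (σs n) x / s n) atTop (𝓝 (L x))) ∧
      0 < ∑ x ∈ G.infoSet j y, L x ∧
      ∀ m m', m :: y ∈ G.nodes → m' :: y ∈ G.nodes → 0 < σ y m →
        ∑ x ∈ G.infoSet j y, L x * G.continuation σ (G.payoff j) (m' :: x) ≤
          ∑ x ∈ G.infoSet j y, L x * G.continuation σ (G.payoff j) (m :: x)) :
    ∃ ψ, G.IsSequentialEquilibrium ψ σ := by
  set ψs : ℕ → List M → ℝ := fun n y => match G.mover y with
    | some j => reach (σs n) y / ∑ x ∈ G.infoSet j y, reach (σs n) x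
    | none => 0 with hψs
  have hψ : ∀ n j y, G.IsDecision j y →
      ψs n y = reach (σs n) y / ∑ x ∈ G.infoSet j y, reach (σs n) x := by
    intro n j y hy
    simp only [hψs, hy.2]
  have hconv : ∀ j y, G.IsDecision j y → ∀ (s : ℕ → ℝ) (L : List M → ℝ), (∀ n, 0 < s n) →
      (∀ x ∈ G.infoSet j y, Tendsto (fun n => reach (σs n) x / s n) atTop (𝓝 (L x))) →
      0 < ∑ x ∈ G.infoSet j y, L x → ∀ x ∈ G.infoSet j y,
      Tendsto (fun n => ψs n x) atTop (𝓝 (L x / ∑ x ∈ G.infoSet j y, L x)) := by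
    intro j y hy s L hs hL hpos x hx
    obtain ⟨hx1, hx2⟩ := G.mem_infoSet.1 hx
    -- The scale `s n` is common to the whole information set and cancels in Bayes' rule.
    refine ((hL x hx).div (tendsto_finsetSum _ hL) hpos.ne').congr fun n => ?_
    rw [hψ n j x hx1, G.infoSet_congr hx2, Pi.div_apply, ← Finset.sum_div,
      div_div_div_cancel_right₀ (hs n).ne']
  have hex : ∀ y, ∃ l, ∀ j, G.IsDecision j y → Tendsto (fun n => ψs n y) atTop (𝓝 l) := by
    intro y
    by_cases h : ∃ j, G.IsDecision j y
    · obtain ⟨j, hj⟩ := h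
      obtain ⟨s, L, hs, hL, hpos, -⟩ := hbel j y hj
      exact ⟨_, fun _ _ => hconv j y hj s L hs hL hpos y (G.self_mem_infoSet hj)⟩
    · exact ⟨0, fun j hj => absurd ⟨j, hj⟩ h⟩
  choose ψ hψlim using hex
  refine ⟨ψ, hσ, hnat, ⟨ψs, σs, fun n => ⟨hp n, hmix n, fun i y hy => hψ n i y hy⟩, hlim,
    fun i y hy => hψlim y i hy⟩, fun j y hy m m' hm hm' h0 => ?_⟩
  obtain ⟨s, L, hs, hL, hpos, hopt⟩ := hbel j y hy
  have heq : ∀ x ∈ G.infoSet j y, ψ x = L x / ∑ x ∈ G.infoSet j y, L x := fun x hx =>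
    tendsto_nhds_unique (hψlim x j (G.mem_infoSet.1 hx).1) (hconv j y hy s L hs hL hpos x hx)
  have hval : ∀ m, G.moveValue ψ σ j y m =
      (∑ x ∈ G.infoSet j y, L x * G.continuation σ (G.payoff j) (m :: x)) /
        ∑ x ∈ G.infoSet j y, L x := by
    intro m
    rw [moveValue_eq, Finset.sum_div]
    refine Finset.sum_congr rfl fun x hx => ?_
    rw [heq x hx]
    ring
  rw [hval, hval]
  exact div_le_div_of_nonneg_right (hopt m m' hm hm' h0) hpos.le

end ExtensiveGame

/-! ## Mediated games -/

namespace Mediated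

open ExtensiveGame

/-- `(i, x, y)` is the plan that lets player `i` move first, recommends `x` to `i`, and, if `i`
obeys, recommends `y` to the opponent. -/
abbrev Plan : Type := Fin 2 × Fin 2 × Fin 2

/-- A move is either a plan chosen by Nature or an action chosen by a player. -/
abbrev Move : Type := Plan ⊕ Fin 2

/-- The action profile with `x` for `i` and `y` for the opponent of `i`. -/
abbrev profile (i x y : Fin 2) : Fin 2 → Fin 2 := pair (A := fun _ => Fin 2) i x y

/-- The intended action profile of a plan. -/
abbrev Plan.outcome (t : Plan) : Fin 2 → Fin 2 := profile t.1 t.2.1 t.2.2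

theorem profile_opp (i x y : Fin 2) : profile (opp i) x y = profile i y x := by
  refine profile_ext (A := fun _ => Fin 2) (opp i) ?_ ?_
  · rw [profile, profile, pair_self, pair_opp]
  · rw [profile, profile, pair_opp]
    have : ∀ j, j = i → y = pair (A := fun _ => Fin 2) i y x j := by
      rintro _ rfl
      rw [pair_self]
    exact this _ (opp_opp i)

/-- The recommendation to the second player if the first one plays `x`. -/
def message (pun : Fin 2 → Fin 2 → Fin 2) (t : Plan) (x : Fin 2) : Fin 2 :=
  if x = t.2.1 then t.2.2 else pun t.1 x

/-- The histories, if Nature chooses a plan in `T`. -/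
def nodes (T : Finset Plan) : Finset (List Move) :=
  insert [] (T.image (fun t => [.inl t]) ∪
    ((T ×ˢ Finset.univ).image fun p : Plan × Fin 2 => [.inr p.2, .inl p.1]) ∪
    ((T ×ˢ Finset.univ).image fun p : Plan × Fin 2 × Fin 2 =>
      [.inr p.2.2, .inr p.2.1, .inl p.1]))

/-- The mover at a history. -/
def mover : List Move → Option (Fin 2)
  | [.inl t] => some t.1
  | [.inr _, .inl t] => some (opp t.1)
  | _ => none

/-- A player only learns the action that is recommended to him. -/
def info (pun : Fin 2 → Fin 2 → Fin 2) : List Move → Fin 2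
  | [.inl t] => t.2.1
  | [.inr x, .inl t] => message pun t x
  | _ => 0

/-- The action profile at the end of a history. -/
def result : List Move → Fin 2 → Fin 2
  | [.inr y, .inr x, .inl t] => profile t.1 x y
  | _ => fun _ => 0

theorem mem_nodes {T : Finset Plan} {z : List Move} :
    z ∈ nodes T ↔ z = [] ∨ (∃ t ∈ T, z = [.inl t]) ∨ (∃ t ∈ T, ∃ x, z = [.inr x, .inl t]) ∨
      ∃ t ∈ T, ∃ x y, z = [.inr y, .inr x, .inl t] := by
  simp only [nodes, Finset.mem_insert, Finset.mem_union, Finset.mem_image, Finset.mem_product,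
    Finset.mem_univ, and_true, Prod.exists, or_assoc, eq_comm (a := z)]
  grind

/-- The tree of the mediated game. -/
def tree (T : Finset Plan) (pun : Fin 2 → Fin 2 → Fin 2) : GameTree Move (Fin 2) where
  nodes := nodes T
  root_mem := mem_nodes.2 (.inl rfl)
  pred_mem m x h := by
    rw [mem_nodes] at h ⊢
    grind
  mover := mover
  info _ := info pun

variable {T : Finset Plan} {pun : Fin 2 → Fin 2 → Fin 2}

theorem isDecision_iff {j : Fin 2} {y : List Move} : (tree T pun).IsDecision j y ↔
    (∃ t ∈ T, t.1 = j ∧ y = [.inl t]) ∨ ∃ t ∈ T, ∃ x, opp t.1 = j ∧ y = [.inr x, .inl t] := by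
  constructor
  · rintro ⟨⟨h, -⟩, hm⟩
    rcases mem_nodes.1 h with rfl | ⟨t, ht, rfl⟩ | ⟨t, ht, x, rfl⟩ | ⟨t, ht, x, y, rfl⟩
    · simp [tree, mover] at hm
    · exact .inl ⟨t, ht, by simpa [tree, mover] using hm, rfl⟩
    · exact .inr ⟨t, ht, x, by simpa [tree, mover] using hm, rfl⟩
    · simp [tree, mover] at hm
  · rintro (⟨t, ht, rfl, rfl⟩ | ⟨t, ht, x, rfl, rfl⟩)
    · exact ⟨⟨mem_nodes.2 (.inr (.inl ⟨t, ht, rfl⟩)), .inr 0,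
        mem_nodes.2 (.inr (.inr (.inl ⟨t, ht, 0, rfl⟩)))⟩, rfl⟩
    · exact ⟨⟨mem_nodes.2 (.inr (.inr (.inl ⟨t, ht, x, rfl⟩))), .inr 0,
        mem_nodes.2 (.inr (.inr (.inr ⟨t, ht, x, 0, rfl⟩)))⟩, rfl⟩

theorem cons_mem_iff {j : Fin 2} {y : List Move} (h : (tree T pun).IsDecision j y) (m : Move) :
    m :: y ∈ (tree T pun).nodes ↔ ∃ a, m = .inr a := by
  change m :: y ∈ nodes T ↔ _
  rw [mem_nodes]
  rcases isDecision_iff.1 h with ⟨t, ht, -, rfl⟩ | ⟨t, ht, x, -, rfl⟩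
  · simp [ht]
  · simp [ht]

theorem nil_cons_mem_iff (m : Move) :
    [m] ∈ (tree T pun).nodes ↔ ∃ t ∈ T, m = .inl t := by
  change [m] ∈ nodes T ↔ _
  rw [mem_nodes]
  simp

theorem isInner_iff {y : List Move} (hy : (tree T pun).IsInner y) :
    y = [] ∨ ∃ j, (tree T pun).IsDecision j y := by
  obtain ⟨h, m, hm⟩ := id hy
  rcases mem_nodes.1 h with rfl | ⟨t, ht, rfl⟩ | ⟨t, ht, x, rfl⟩ | ⟨t, ht, x, y, rfl⟩
  · exact .inl rfl
  · exact .inr ⟨_, hy, rfl⟩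
  · exact .inr ⟨_, hy, rfl⟩
  · simpa using mem_nodes.1 hm

theorem mem_terminals (hT : T.Nonempty) {z : List Move} : z ∈ (tree T pun).terminals ↔
    ∃ t ∈ T, ∃ x y, z = [.inr y, .inr x, .inl t] := by
  rw [GameTree.mem_terminals]
  constructor
  · rintro ⟨h, hz⟩
    rcases mem_nodes.1 h with rfl | ⟨t, ht, rfl⟩ | ⟨t, ht, x, rfl⟩ | h
    · obtain ⟨t, ht⟩ := hT
      exact absurd (mem_nodes.2 (.inr (.inl ⟨t, ht, rfl⟩))) (hz (.inl t))
    · exact absurd (mem_nodes.2 (.inr (.inr (.inl ⟨t, ht, 0, rfl⟩)))) (hz (.inr 0))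
    · exact absurd (mem_nodes.2 (.inr (.inr (.inr ⟨t, ht, x, 0, rfl⟩)))) (hz (.inr 0))
    · exact h
  · rintro ⟨t, ht, x, y, rfl⟩
    refine ⟨mem_nodes.2 (.inr (.inr (.inr ⟨t, ht, x, y, rfl⟩))), fun m hm => ?_⟩
    simpa using mem_nodes.1 hm

end Mediated

end InterdependentChoice

/-! ### Obedient play, and mediated games as mechanisms. -/

namespace InterdependentChoice

open Filter Topology

namespace Mediated

open ExtensiveGame

variable {T : Finset Plan} {pun : Fin 2 → Fin 2 → Fin 2}

/-- Play the action `c` and tremble with probability `δ`. -/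
def obey (δ : ℝ) (c x : Fin 2) : ℝ :=
  if x = c then 1 - δ else δ

theorem sum_obey (δ : ℝ) (c : Fin 2) : ∑ x, obey δ c x = 1 := by
  fin_cases c <;> simp [obey]

/-- Nature draws a plan from `ν` and both players obey, up to trembles. -/
def strategy (pun : Fin 2 → Fin 2 → Fin 2) (ν : Plan → ℝ) (δ : ℝ) : List Move → Move → ℝ
  | [] => Sum.elim ν 0
  | [.inl t] => Sum.elim 0 (obey δ t.2.1)
  | [.inr x, .inl t] => Sum.elim 0 (obey δ (message pun t x))
  | _ => 0

theorem strategy_of_isDecision {j : Fin 2} {y : List Move} (hy : (tree T pun).IsDecision j y)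
    (ν : Plan → ℝ) (δ : ℝ) :
    strategy pun ν δ y = (Sum.elim 0 (obey δ (info pun y)) : Move → ℝ) := by
  rcases isDecision_iff.1 hy with ⟨t, ht, -, rfl⟩ | ⟨t, ht, x, -, rfl⟩ <;> rfl

theorem isMoveDist_nil {ν : Plan → ℝ} (hν : ν ∈ stdSimplex ℝ Plan) (hT : ∀ t ∉ T, ν t = 0)
    (δ : ℝ) : (tree T pun).IsMoveDist [] (strategy pun ν δ []) := by
  refine ⟨⟨?_, ?_⟩, ?_⟩
  · rintro (t | x)
    · exact hν.1 t
    · exact le_rfl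
  · rw [Fintype.sum_sum_type]
    simpa [strategy] using hν.2
  · rintro (t | x) h
    · exact hT t fun ht => h ((nil_cons_mem_iff _).2 ⟨t, ht, rfl⟩)
    · rfl

theorem isMoveDist_of_isDecision {j : Fin 2} {y : List Move}
    (hy : (tree T pun).IsDecision j y) (ν : Plan → ℝ) {δ : ℝ} (h0 : 0 ≤ δ) (h1 : δ ≤ 1) :
    (tree T pun).IsMoveDist y (strategy pun ν δ y) := by
  rw [strategy_of_isDecision hy]
  refine ⟨⟨?_, ?_⟩, ?_⟩
  · rintro (t | x)
    · exact le_rfl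
    · simp only [Sum.elim_inr, obey]
      split_ifs <;> linarith
  · rw [Fintype.sum_sum_type]
    simpa using sum_obey δ _
  · rintro (t | x) h
    · rfl
    · exact absurd ((cons_mem_iff hy _).2 ⟨x, rfl⟩) h

/-- The mediated game with payoffs `u`, in which Nature draws the plan from `ν`. -/
def game (T : Finset Plan) (pun : Fin 2 → Fin 2 → Fin 2) (u : Fin 2 → (Fin 2 → Fin 2) → ℝ)
    (ν : Plan → ℝ) (hν : ν ∈ stdSimplex ℝ Plan) (hT : ∀ t ∉ T, ν t = 0) :
    ExtensiveGame Move (Fin 2) where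
  toGameTree := tree T pun
  moves_eq i x y hx hy _ m := by rw [cons_mem_iff hx, cons_mem_iff hy]
  perfect_recall i x y hx hy _ := by
    -- Each player moves only once along a play, so his record at a decision node is empty.
    have key : ∀ x, (tree T pun).IsDecision i x → (tree T pun).experience i x = [] := by
      intro x hx
      rcases isDecision_iff.1 hx with ⟨t, ht, rfl, rfl⟩ | ⟨t, ht, x, rfl, rfl⟩
      · simp [GameTree.experience, tree, mover]
      · simp [GameTree.experience, tree, mover, (opp_ne t.1).symm]
    rw [key x hx, key y hy]
  chance := strategy pun ν 0
  chance_dist x hx hm := by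
    rcases isInner_iff hx with rfl | ⟨j, hj⟩
    · exact isMoveDist_nil hν hT 0
    · rw [hj.2] at hm
      cases hm
  payoff i z := u i (result z)

section Game

variable {u : Fin 2 → (Fin 2 → Fin 2) → ℝ} {ν : Plan → ℝ} {hν : ν ∈ stdSimplex ℝ Plan}
  {hT : ∀ t ∉ T, ν t = 0}

theorem nonempty_of_mem_stdSimplex (hν : ν ∈ stdSimplex ℝ Plan) (hT : ∀ t ∉ T, ν t = 0) :
    T.Nonempty := by
  obtain ⟨t, ht⟩ := exists_pos_of_mem_stdSimplex hν
  exact ⟨t, by_contra fun h => ht.ne' (hT t h)⟩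

theorem isProfile_strategy {ν' : Plan → ℝ} (hν' : ν' ∈ stdSimplex ℝ Plan)
    (hT' : ∀ t ∉ T, ν' t = 0) {δ : ℝ} (h0 : 0 ≤ δ) (h1 : δ ≤ 1) :
    (game T pun u ν hν hT).IsProfile (strategy pun ν' δ) where
  dist x hx := by
    rcases isInner_iff hx with rfl | ⟨j, hj⟩
    · exact isMoveDist_nil hν' hT' δ
    · exact isMoveDist_of_isDecision hj ν' h0 h1
  info_const i x y hx hy h := by
    have h' : info pun x = info pun y := h
    rw [strategy_of_isDecision hx, strategy_of_isDecision hy, h']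

theorem isStrictlyMixed_strategy {ν' : Plan → ℝ} (hT' : ∀ t ∈ T, 0 < ν' t)
    {δ : ℝ} (h0 : 0 < δ) (h1 : δ < 1) :
    (game T pun u ν hν hT).IsStrictlyMixed (strategy pun ν' δ) := by
  intro x m hm
  rcases isInner_iff (GameTree.isInner_of_cons _ hm) with rfl | ⟨j, hj⟩
  · obtain ⟨t, ht, rfl⟩ := (nil_cons_mem_iff m).1 hm
    exact hT' t ht
  · obtain ⟨a, rfl⟩ := (cons_mem_iff hj m).1 hm
    rw [strategy_of_isDecision hj]
    simp only [Sum.elim_inr, obey]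
    split_ifs <;> linarith

theorem result_of_suffix (hT0 : T.Nonempty) {i : Fin 2} {y z : List Move} {a : Fin 2}
    (hy : (tree T pun).IsDecision i y) (hz : z ∈ (tree T pun).terminals)
    (hs : (Sum.inr a :: y) <:+ z) : result z i = a := by
  obtain ⟨t, ht, b, c, rfl⟩ := (mem_terminals hT0).1 hz
  rcases isDecision_iff.1 hy with ⟨t', -, rfl, rfl⟩ | ⟨t', -, x, rfl, rfl⟩
  · simp [List.suffix_cons_iff] at hs
    obtain ⟨rfl, rfl⟩ := hs
    simp [result]
  · simp [List.suffix_cons_iff] at hs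
    obtain ⟨rfl, rfl, rfl⟩ := hs
    simp [result]

theorem represents_iff {B : Fin 2 → Type*} (e : ∀ i, Fin 2 ≃ B i) {i : Fin 2} {y : List Move}
    (hy : (tree T pun).IsDecision i y) (m : Move) (a : B i) :
    (game T pun u ν hν hT).Represents (fun z j => e j (result z j)) i y m a ↔
      m = .inr ((e i).symm a) := by
  have hT0 := nonempty_of_mem_stdSimplex hν hT
  constructor
  · rintro ⟨hm, ha, -⟩
    obtain ⟨b, rfl⟩ := (cons_mem_iff hy m).1 hm
    obtain ⟨z, hz, hs⟩ := GameTree.exists_terminal _ hm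
    rw [← ha z hz hs, Equiv.symm_apply_apply, result_of_suffix hT0 hy hz hs]
  · rintro rfl
    refine ⟨(cons_mem_iff hy _).2 ⟨_, rfl⟩, fun z hz hs => ?_, ?_⟩
    · change e i (result z i) = a
      rw [result_of_suffix hT0 hy hz hs, Equiv.apply_symm_apply]
    · obtain ⟨b, hb⟩ := exists_ne ((e i).symm a)
      have hm := (cons_mem_iff hy (.inr b)).2 ⟨b, rfl⟩
      obtain ⟨z, hz, hs⟩ := GameTree.exists_terminal _ hm
      refine ⟨.inr b, hm, z, hz, hs, fun h => hb ?_⟩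
      change e i (result z i) = a at h
      rw [result_of_suffix hT0 hy hz hs] at h
      rw [← h, Equiv.symm_apply_apply]

/-- At each decision node the two moves represent the mover's two actions, so every decision node is
pivotal. -/
theorem isMechanism_game {B : Fin 2 → Type*} (e : ∀ i, Fin 2 ≃ B i)
    {v : Fin 2 → (∀ i, B i) → ℝ} (hv : ∀ i a, u i a = v i fun j => e j (a j)) :
    (game T pun u ν hν hT).IsMechanism v (fun z j => e j (result z j)) where
  onto a := by
    obtain ⟨t, ht⟩ := nonempty_of_mem_stdSimplex hν hT
    refine ⟨[.inr ((e (opp t.1)).symm (a (opp t.1))), .inr ((e t.1).symm (a t.1)), .inl t],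
      (mem_terminals ⟨t, ht⟩).2 ⟨t, ht, _, _, rfl⟩, profile_ext t.1 ?_ ?_⟩
    · simp [result]
    · simp [result]
  payoff_eq z _ i := hv i _
  full_disclosure i x y hx hy _ m a := by rw [represents_iff e hx, represents_iff e hy]
  pivotal z hz i := by
    have key : ∀ y b, (tree T pun).IsDecision i y → (Sum.inr b :: y) <:+ z →
        ∃ y m, (game T pun u ν hν hT).IsPivotal (fun z j => e j (result z j)) i y ∧
          (game T pun u ν hν hT).Represents (fun z j => e j (result z j)) i y m
            (e i (result z i)) ∧ (m :: y) <:+ z := by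
      intro y b hy hs
      refine ⟨y, .inr b, ⟨hy, fun a => ⟨_, (represents_iff e hy _ a).2 rfl⟩⟩,
        (represents_iff e hy _ _).2 ?_, hs⟩
      rw [result_of_suffix (nonempty_of_mem_stdSimplex hν hT) hy hz hs, Equiv.symm_apply_apply]
    obtain ⟨t, ht, x, y, rfl⟩ := (mem_terminals (nonempty_of_mem_stdSimplex hν hT)).1 hz
    rcases eq_or_eq_opp t.1 i with rfl | rfl
    · exact key [.inl t] x (isDecision_iff.2 (.inl ⟨t, ht, rfl, rfl⟩)) (List.suffix_cons _ _)
    · exact key [.inr x, .inl t] y (isDecision_iff.2 (.inr ⟨t, ht, x, rfl, rfl⟩)) List.suffix_rfl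

theorem continuation_end {σ : List Move → Move → ℝ} (g : (Fin 2 → Fin 2) → ℝ) {t : Plan}
    (ht : t ∈ T) (x y : Fin 2) :
    (game T pun u ν hν hT).continuation σ (fun z => g (result z)) [.inr y, .inr x, .inl t] =
      g (profile t.1 x y) :=
  continuation_terminal _ ((mem_terminals ⟨t, ht⟩).2 ⟨t, ht, x, y, rfl⟩)

theorem sum_obey_zero_mul (c : Fin 2) (f : Fin 2 → ℝ) : ∑ x, obey 0 c x * f x = f c := by
  simp [obey]

theorem continuation_second {ν' : Plan → ℝ} (g : (Fin 2 → Fin 2) → ℝ) {t : Plan}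
    (ht : t ∈ T) (x : Fin 2) :
    (game T pun u ν hν hT).continuation (strategy pun ν' 0) (fun z => g (result z))
      [.inr x, .inl t] = g (profile t.1 x (message pun t x)) := by
  rw [continuation_inner _ (isDecision_iff.2 (.inr ⟨t, ht, x, rfl, rfl⟩)).1,
    Fintype.sum_sum_type]
  simp only [strategy, Sum.elim_inl, Sum.elim_inr, Pi.zero_apply, zero_mul,
    Finset.sum_const_zero, zero_add, continuation_end g ht, sum_obey_zero_mul]

theorem continuation_first {ν' : Plan → ℝ} (g : (Fin 2 → Fin 2) → ℝ) {t : Plan} (ht : t ∈ T) :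
    (game T pun u ν hν hT).continuation (strategy pun ν' 0) (fun z => g (result z)) [.inl t] =
      g t.outcome := by
  rw [continuation_inner _ (isDecision_iff.2 (.inl ⟨t, ht, rfl, rfl⟩)).1, Fintype.sum_sum_type]
  simp only [strategy, Sum.elim_inl, Sum.elim_inr, Pi.zero_apply, zero_mul,
    Finset.sum_const_zero, zero_add, continuation_second g ht, sum_obey_zero_mul]
  simp [message]

theorem continuation_root (g : (Fin 2 → Fin 2) → ℝ) :
    (game T pun u ν hν hT).continuation (strategy pun ν 0) (fun z => g (result z)) [] =
      ∑ t, ν t * g t.outcome := by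
  obtain ⟨t, ht⟩ := nonempty_of_mem_stdSimplex hν hT
  rw [continuation_inner _ ⟨(game T pun u ν hν hT).root_mem, .inl t,
    mem_nodes.2 (.inr (.inl ⟨t, ht, rfl⟩))⟩, Fintype.sum_sum_type]
  simp only [strategy, Sum.elim_inl, Sum.elim_inr, Pi.zero_apply, zero_mul,
    Finset.sum_const_zero, add_zero]
  refine Finset.sum_congr rfl fun t _ => ?_
  by_cases ht : t ∈ T
  · rw [continuation_first g ht]
  · rw [hT t ht, zero_mul, zero_mul]

/-- A recommendation may reach `j` as first or as second mover; the second sum includes the nodes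
that follow a deviation of the first mover. -/
theorem sum_infoSet {j c : Fin 2} {y : List Move} (hc : info pun y = c) (F : List Move → ℝ) :
    ∑ x ∈ (tree T pun).infoSet j y, F x =
      (∑ t ∈ T, if t.1 = j ∧ t.2.1 = c then F [.inl t] else 0) +
        ∑ t ∈ T, ∑ x, if opp t.1 = j ∧ message pun t x = c then F [.inr x, .inl t] else 0 := by
  classical
  have h : (tree T pun).infoSet j y =
      ((T.filter fun t => t.1 = j ∧ t.2.1 = c).image fun t => [Sum.inl t]) ∪
        (((T ×ˢ Finset.univ).filter fun p : Plan × Fin 2 =>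
          opp p.1.1 = j ∧ message pun p.1 p.2 = c).image fun p => [.inr p.2, .inl p.1]) := by
    ext x
    rw [GameTree.mem_infoSet, isDecision_iff]
    simp only [Finset.mem_union, Finset.mem_image, Finset.mem_filter, Finset.mem_product,
      Finset.mem_univ, and_true, ← hc]
    constructor
    · rintro ⟨⟨t, ht, h1, rfl⟩ | ⟨t, ht, x', h1, rfl⟩, h2⟩
      · exact .inl ⟨t, ⟨ht, h1, h2⟩, rfl⟩
      · exact .inr ⟨(t, x'), ⟨ht, h1, h2⟩, rfl⟩
    · rintro (⟨t, ⟨ht, h1, h2⟩, rfl⟩ | ⟨⟨t, x'⟩, ⟨ht, h1, h2⟩, rfl⟩)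
      · exact ⟨.inl ⟨t, ht, h1, rfl⟩, h2⟩
      · exact ⟨.inr ⟨t, ht, x', h1, rfl⟩, h2⟩
  rw [h, Finset.sum_union, Finset.sum_image, Finset.sum_image, Finset.sum_filter,
    Finset.sum_filter, Finset.sum_product]
  · rintro ⟨t, x⟩ _ ⟨t', x'⟩ _ h
    simpa [and_comm] using h
  · intro t _ t' _ h
    simpa using h
  · rw [Finset.disjoint_left]
    simp only [Finset.mem_image]
    rintro _ ⟨t, _, rfl⟩ ⟨p, _, h⟩
    simp at h

theorem reach_first (ν' : Plan → ℝ) (δ : ℝ) (t : Plan) :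
    reach (strategy pun ν' δ) [.inl t] = ν' t := by
  simp [reach_cons, strategy]

theorem reach_second (ν' : Plan → ℝ) (δ : ℝ) (t : Plan) (x : Fin 2) :
    reach (strategy pun ν' δ) [.inr x, .inl t] = ν' t * obey δ t.2.1 x := by
  rw [reach_cons, reach_first]
  simp [strategy]

/-- Without trembles the nodes after a deviation have probability zero, so each plan contributes
only at its intended histories. -/
theorem sum_infoSet_reach (hT : ∀ t ∉ T, ν t = 0) {j c : Fin 2} {y : List Move}
    (hc : info pun y = c) (F : List Move → ℝ) :
    ∑ x ∈ (tree T pun).infoSet j y, reach (strategy pun ν 0) x * F x =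
      ∑ t, ((if t.1 = j ∧ t.2.1 = c then ν t * F [.inl t] else 0) +
        if opp t.1 = j ∧ t.2.2 = c then ν t * F [.inr t.2.1, .inl t] else 0) := by
  rw [sum_infoSet hc, ← Finset.sum_add_distrib, ← Finset.sum_subset (Finset.subset_univ T)]
  · refine Finset.sum_congr rfl fun t _ => ?_
    congr 1
    · simp only [reach_first]
    · rw [Finset.sum_eq_single_of_mem t.2.1 (Finset.mem_univ _)]
      · simp [reach_second, message, obey]
      · intro x _ hx
        simp [reach_second, obey, hx]
  · intro t _ ht
    simp [hT t ht]

end Game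

end Mediated

end InterdependentChoice

/-! ### Obedience on and off the path, and Nature's trembles. -/

namespace InterdependentChoice

open Filter Topology

namespace Mediated

open ExtensiveGame

variable {T : Finset Plan} {pun : Fin 2 → Fin 2 → Fin 2}
  {u : Fin 2 → (Fin 2 → Fin 2) → ℝ} {ν : Plan → ℝ}

/-- The recommendation `c` is made to `j` with positive probability, and it is optimal to obey. -/
def ObedientOnPath (pun : Fin 2 → Fin 2 → Fin 2) (u : Fin 2 → (Fin 2 → Fin 2) → ℝ)
    (ν : Plan → ℝ) (j c : Fin 2) : Prop :=
  0 < ∑ t : Plan, ((if t.1 = j ∧ t.2.1 = c then ν t else 0) +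
      if opp t.1 = j ∧ t.2.2 = c then ν t else 0) ∧
    ∀ c', 0 ≤ ∑ t : Plan,
      ((if t.1 = j ∧ t.2.1 = c then
          ν t * (u j t.outcome - u j (profile t.1 c' (message pun t c'))) else 0) +
        if opp t.1 = j ∧ t.2.2 = c then
          ν t * (u j t.outcome - u j (profile t.1 t.2.1 c')) else 0)

/-- The recommendation `c` is never made to `j`, but among the plans that would lead to it there
is a most likely one in the sense of the orders `e` of Nature's trembles; under this plan `j` moves
first and it is optimal for him to obey. -/
def ObedientOffPath (T : Finset Plan) (pun : Fin 2 → Fin 2 → Fin 2)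
    (u : Fin 2 → (Fin 2 → Fin 2) → ℝ) (ν : Plan → ℝ) (e : Plan → ℕ) (j c : Fin 2) : Prop :=
  (∀ t : Plan, (t.1 = j ∧ t.2.1 = c) ∨ (opp t.1 = j ∧ t.2.2 = c) → ν t = 0) ∧
    ∃ s ∈ T, s.1 = j ∧ s.2.1 = c ∧ e s < 3 ∧
      (∀ c', u j (profile j c' (message pun s c')) ≤ u j s.outcome) ∧
      ∀ t ∈ T, t ≠ s → (t.1 = j ∧ t.2.1 = c) ∨ (opp t.1 = j ∧ t.2.2 = c) → e s < e t

/-- The distribution `ν` with trembles of order `e t` onto the plans `t` in `T`. -/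
noncomputable def tremble (T : Finset Plan) (ν : Plan → ℝ) (e : Plan → ℕ) (ε : ℝ) (t : Plan) : ℝ :=
  if t ∈ T then (ν t + ε ^ e t) / (1 + ∑ s ∈ T, ε ^ e s) else 0

section Tremble

variable {e : Plan → ℕ} {ε : ℝ}

theorem tremble_denom_pos (hε : 0 < ε) : 0 < 1 + ∑ s ∈ T, ε ^ e s :=
  add_pos_of_pos_of_nonneg one_pos (Finset.sum_nonneg fun _ _ => (pow_pos hε _).le)

theorem tremble_pos (hν : ν ∈ stdSimplex ℝ Plan) (hε : 0 < ε) {t : Plan} (ht : t ∈ T) :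
    0 < tremble T ν e ε t := by
  rw [tremble, if_pos ht]
  exact div_pos (add_pos_of_nonneg_of_pos (hν.1 t) (pow_pos hε _)) (tremble_denom_pos hε)

theorem tremble_of_notMem {t : Plan} (ht : t ∉ T) : tremble T ν e ε t = 0 :=
  if_neg ht

theorem tremble_mem_stdSimplex (hν : ν ∈ stdSimplex ℝ Plan) (hT : ∀ t ∉ T, ν t = 0)
    (hε : 0 < ε) : tremble T ν e ε ∈ stdSimplex ℝ Plan := by
  refine ⟨fun t => ?_, ?_⟩
  · by_cases ht : t ∈ T
    · exact (tremble_pos hν hε ht).le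
    · exact (tremble_of_notMem ht).ge
  · have h1 : ∑ t ∈ T, ν t = 1 := by
      rw [← hν.2]
      exact Finset.sum_subset (Finset.subset_univ T) fun t _ ht => hT t ht
    rw [← Finset.sum_subset (Finset.subset_univ T) fun t _ ht => tremble_of_notMem ht,
      Finset.sum_congr rfl fun t ht => show tremble T ν e ε t =
        (ν t + ε ^ e t) / (1 + ∑ s ∈ T, ε ^ e s) from if_pos ht,
      ← Finset.sum_div, Finset.sum_add_distrib, h1, div_self (tremble_denom_pos hε).ne']

variable {εs : ℕ → ℝ}

theorem tendsto_tremble_denom (he : ∀ t, 1 ≤ e t) (h : Tendsto εs atTop (𝓝 0)) :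
    Tendsto (fun n => 1 + ∑ s ∈ T, εs n ^ e s) atTop (𝓝 1) := by
  have : Tendsto (fun n => ∑ s ∈ T, εs n ^ e s) atTop (𝓝 (∑ s ∈ T, 0)) := by
    refine tendsto_finsetSum _ fun s _ => ?_
    have := h.pow (e s)
    rwa [zero_pow (Nat.one_le_iff_ne_zero.1 (he s))] at this
  simpa using tendsto_const_nhds.add this

theorem tendsto_tremble (hT : ∀ t ∉ T, ν t = 0) (he : ∀ t, 1 ≤ e t)
    (h : Tendsto εs atTop (𝓝 0)) (t : Plan) :
    Tendsto (fun n => tremble T ν e (εs n) t) atTop (𝓝 (ν t)) := by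
  by_cases ht : t ∈ T
  · simp only [tremble, if_pos ht]
    have h1 := h.pow (e t)
    rw [zero_pow (Nat.one_le_iff_ne_zero.1 (he t))] at h1
    have h2 := (h1.const_add (ν t)).div (tendsto_tremble_denom (T := T) he h) one_ne_zero
    rwa [add_zero, div_one] at h2
  · simp only [tremble_of_notMem ht, hT t ht]
    exact tendsto_const_nhds

/-- A plan of prior probability zero is trembled onto with a probability of exact order `e t`, so on
the scale `ε ^ k` only plans of order `k` survive. -/
theorem tendsto_tremble_div_pow (he : ∀ t, 1 ≤ e t) (hpos : ∀ n, 0 < εs n)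
    (h : Tendsto εs atTop (𝓝 0)) {t : Plan} (ht : t ∈ T) (hν : ν t = 0) {k : ℕ} (hk : k ≤ e t) :
    Tendsto (fun n => tremble T ν e (εs n) t / εs n ^ k) atTop
      (𝓝 (if k = e t then 1 else 0)) := by
  have h1 : Tendsto (fun n => εs n ^ (e t - k)) atTop (𝓝 (if k = e t then 1 else 0)) := by
    have := h.pow (e t - k)
    split_ifs with hke
    · simp [hke]
    · rwa [zero_pow (by omega)] at this
  have h2 := h1.div (tendsto_tremble_denom (T := T) he h) one_ne_zero
  rw [div_one] at h2
  refine h2.congr fun n => ?_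
  rw [Pi.div_apply, tremble, if_pos ht, hν, zero_add, div_right_comm,
    pow_sub₀ _ (hpos n).ne' hk, div_eq_mul_inv (εs n ^ e t)]

end Tremble

/-- Players tremble with order 3, while the plan that supports an unused recommendation has order
below 3. Hence such a recommendation is attributed to Nature rather than to a deviation of the first
mover. -/
theorem exists_isSequentialEquilibrium_game (hν : ν ∈ stdSimplex ℝ Plan)
    (hT : ∀ t ∉ T, ν t = 0) {e : Plan → ℕ} (he : ∀ t, 1 ≤ e t)
    (h : ∀ j y, (tree T pun).IsDecision j y → ObedientOnPath pun u ν j (info pun y) ∨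
      ObedientOffPath T pun u ν e j (info pun y)) :
    ∃ ψ, (game T pun u ν hν hT).IsSequentialEquilibrium ψ (strategy pun ν 0) := by
  -- The shift by one keeps `εs 0` below 1, as strict mixing requires.
  set εs : ℕ → ℝ := fun n => 1 / ((n + 1 : ℕ) + 1) with hεs
  have hpos : ∀ n, 0 < εs n := fun n => Nat.one_div_pos_of_nat
  have hlt : ∀ n, εs n < 1 := fun n => by
    rw [hεs, div_lt_one (by positivity)]
    push_cast
    linarith [(Nat.cast_nonneg n : (0 : ℝ) ≤ n)]
  have hεlim : Tendsto εs atTop (𝓝 0) :=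
    (tendsto_one_div_add_atTop_nhds_zero_nat (𝕜 := ℝ)).comp (tendsto_add_atTop_nat 1)
  set σs : ℕ → List Move → Move → ℝ :=
    fun n => strategy pun (tremble T ν e (εs n)) (εs n ^ 3) with hσs
  have hδlim : Tendsto (fun n => εs n ^ 3) atTop (𝓝 0) := by
    simpa using hεlim.pow 3
  have hlim : ∀ x, (tree T pun).IsInner x → ∀ m,
      Tendsto (fun n => σs n x m) atTop (𝓝 (strategy pun ν 0 x m)) := by
    intro x hx m
    rcases isInner_iff hx with rfl | ⟨j, hj⟩
    · rcases m with t | a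
      · exact tendsto_tremble hT he hεlim t
      · exact tendsto_const_nhds
    · simp only [hσs, strategy_of_isDecision hj]
      rcases m with t | a
      · exact tendsto_const_nhds
      · simp only [Sum.elim_inr, obey]
        split_ifs
        · exact hδlim.const_sub 1
        · exact hδlim
  refine exists_isSequentialEquilibrium (σs := σs)
    (isProfile_strategy hν hT le_rfl zero_le_one) (fun _ _ _ => rfl)
    (fun n => isProfile_strategy (tremble_mem_stdSimplex hν hT (hpos n))
      (fun t ht => tremble_of_notMem ht) (pow_pos (hpos n) 3).le
      (pow_le_one₀ (hpos n).le (hlt n).le))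
    (fun n => isStrictlyMixed_strategy (fun t ht => tremble_pos hν (hpos n) ht)
      (pow_pos (hpos n) 3) (pow_lt_one₀ (hpos n).le (hlt n) (by norm_num)))
    hlim fun j y hy => ?_
  have hmoves : ∀ m m', m :: y ∈ (tree T pun).nodes → m' :: y ∈ (tree T pun).nodes →
      0 < strategy pun ν 0 y m → m = .inr (info pun y) ∧ ∃ c', m' = .inr c' := by
    intro m m' hm hm' h0
    obtain ⟨a, rfl⟩ := (cons_mem_iff hy m).1 hm
    refine ⟨?_, (cons_mem_iff hy m').1 hm'⟩
    rw [strategy_of_isDecision hy] at h0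
    by_contra hne
    simp only [Sum.elim_inr, obey] at h0
    rw [if_neg fun h => hne (congrArg _ h)] at h0
    exact lt_irrefl _ h0
  -- On the path no rescaling is needed and the weights are the reach probabilities; off the path
  -- the scale `εs n ^ e s` concentrates all weight on `[.inl s]`.
  rcases h j y hy with ⟨hp, hopt⟩ | ⟨h0, s, hs, rfl, hsc, hs3, hopt, hmin⟩
  · refine ⟨fun _ => 1, reach (strategy pun ν 0), fun _ => one_pos, fun x hx => ?_, ?_,
      fun m m' hm hm' hm0 => ?_⟩
    · simp only [div_one]
      exact tendsto_reach (G := game T pun u ν hν hT) hlim (GameTree.mem_infoSet _ |>.1 hx).1.1.1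
    · have := sum_infoSet_reach (pun := pun) hT (j := j) (y := y) rfl fun _ => 1
      simp only [mul_one] at this
      exact hp.trans_eq this.symm
    · obtain ⟨rfl, c', rfl⟩ := hmoves m m' hm hm' hm0
      refine (sum_infoSet_reach hT (j := j) (y := y) rfl _).trans_le
        (le_trans ?_ (sum_infoSet_reach hT (j := j) (y := y) rfl _).ge)
      rw [← sub_nonneg, ← Finset.sum_sub_distrib]
      refine (hopt c').trans_eq (Finset.sum_congr rfl fun t _ => ?_)
      by_cases ht : t ∈ T
      · have e1 : ∀ x, (game T pun u ν hν hT).continuation (strategy pun ν 0)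
            ((game T pun u ν hν hT).payoff j) [.inr x, .inl t] =
            u j (profile t.1 x (message pun t x)) := fun x => continuation_second (u j) ht x
        have e2 : ∀ x y, (game T pun u ν hν hT).continuation (strategy pun ν 0)
            ((game T pun u ν hν hT).payoff j) [.inr y, .inr x, .inl t] =
            u j (profile t.1 x y) := fun x y => continuation_end (u j) ht x y
        rw [add_sub_add_comm]
        congr 1
        · split_ifs with hc
          · rw [e1, e1, ← hc.2]
            simp only [message, if_true]
            ring
          · simp
        · split_ifs with hc
          · rw [e2, e2, ← hc.2]
            ring
          · simp
      · simp [hT t ht]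
  · have hmem : [Sum.inl s] ∈ (game T pun u ν hν hT).infoSet s.1 y :=
      (GameTree.mem_infoSet _).2 ⟨isDecision_iff.2 (.inl ⟨s, hs, rfl, rfl⟩), hsc⟩
    refine ⟨fun n => εs n ^ e s, fun x => if x = [.inl s] then 1 else 0,
      fun n => pow_pos (hpos n) _, fun x hx => ?_, ?_, fun m m' hm hm' hm0 => ?_⟩
    · obtain ⟨hx1, hx2⟩ := (GameTree.mem_infoSet _).1 hx
      rcases isDecision_iff.1 hx1 with ⟨t, ht, h1, rfl⟩ | ⟨t, ht, x, h1, rfl⟩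
      · simp only [hσs, reach_first]
        by_cases hts : t = s
        · subst hts
          simpa using tendsto_tremble_div_pow he hpos hεlim ht (h0 t (.inl ⟨rfl, hsc⟩)) le_rfl
        · have hlt' := hmin t ht hts (.inl ⟨h1, hx2⟩)
          have := tendsto_tremble_div_pow he hpos hεlim ht (h0 t (.inl ⟨h1, hx2⟩)) hlt'.le
          rw [if_neg hlt'.ne] at this
          simpa [hts] using this
      · have hts : t ≠ s := by
          rintro rfl
          exact opp_ne _ h1
        simp only [hσs, reach_second]
        have hne : ([Sum.inr x, Sum.inl t] : List Move) ≠ [.inl s] := by simp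
        rw [if_neg hne]
        by_cases hxt : x = t.2.1
        · have hc : t.2.2 = info pun y := by
            have : message pun t x = info pun y := hx2
            rwa [message, if_pos hxt] at this
          have hlt' := hmin t ht hts (.inr ⟨h1, hc⟩)
          have := (tendsto_tremble_div_pow he hpos hεlim ht (h0 t (.inr ⟨h1, hc⟩)) hlt'.le).mul
            (hδlim.const_sub 1)
          rw [if_neg hlt'.ne, zero_mul] at this
          refine this.congr fun n => ?_
          rw [obey, if_pos hxt]
          ring
        -- After a deviation of the first mover the action tremble `εs n ^ 3` leaves a factor `εs n
        -- ^ (3 - e s)`, which vanishes since `e s < 3`.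
        · have := (tendsto_tremble (ν := ν) hT he hεlim t).mul (hεlim.pow (3 - e s))
          rw [zero_pow (by omega), mul_zero] at this
          refine this.congr fun n => ?_
          rw [obey, if_neg hxt, pow_sub₀ _ (hpos n).ne' hs3.le, div_eq_mul_inv, mul_assoc]
    · rw [Finset.sum_ite_eq', if_pos hmem]
      exact one_pos
    · obtain ⟨rfl, c', rfl⟩ := hmoves m m' hm hm' hm0
      simp only [ite_mul, one_mul, zero_mul]
      rw [Finset.sum_ite_eq', Finset.sum_ite_eq', if_pos hmem, if_pos hmem]
      refine (continuation_second (u s.1) hs c').trans_le ((hopt c').trans_eq ?_)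
      refine Eq.trans ?_ (continuation_second (u s.1) hs _).symm
      rw [← hsc]
      simp [message]

/-- A distribution over plans under which obedience is optimal implements the distribution of the
intended outcomes, whatever the names of the actions are. -/
theorem sequentiallyImplementable {B : Fin 2 → Type*} (b : ∀ i, Fin 2 ≃ B i)
    {v : Fin 2 → (∀ i, B i) → ℝ} (hv : ∀ i a, u i a = v i fun j => b j (a j))
    (hν : ν ∈ stdSimplex ℝ Plan) (hT : ∀ t ∉ T, ν t = 0) {e : Plan → ℕ} (he : ∀ t, 1 ≤ e t)
    (h : ∀ j y, (tree T pun).IsDecision j y → ObedientOnPath pun u ν j (info pun y) ∨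
      ObedientOffPath T pun u ν e j (info pun y)) {α : (∀ i, B i) → ℝ}
    (hα : ∀ a : Fin 2 → Fin 2,
      α (fun j => b j (a j)) = ∑ t, if Plan.outcome t = a then ν t else 0) :
    SequentiallyImplementable v α := by
  classical
  obtain ⟨ψ, hψ⟩ := exists_isSequentialEquilibrium_game hν hT he h
  refine ⟨Move, Fin 2, inferInstance, game T pun u ν hν hT, _, ψ, strategy pun ν 0,
    isMechanism_game b hv, hψ, fun a => ?_⟩
  have hinj : ∀ a' : Fin 2 → Fin 2, (fun j => b j (a' j)) = a ↔ a' = fun j => (b j).symm (a j) := by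
    intro a'
    simp only [funext_iff, Equiv.eq_symm_apply]
  have h1 := hα fun j => (b j).symm (a j)
  simp only [Equiv.apply_symm_apply] at h1
  have h2 := continuation_root (T := T) (pun := pun) (u := u) (hν := hν) (hT := hT)
    fun a' => if (fun j => b j (a' j)) = a then 1 else 0
  simp only [continuation, mul_ite, mul_one, mul_zero, hinj] at h2
  simp only [hinj, h1]
  rw [← h2]
  refine Finset.sum_congr rfl fun z _ => ?_
  split_ifs <;> rfl

end Mediated

end InterdependentChoice

/-! ### Choosing plans, punishments and tremble orders. -/

namespace InterdependentChoice

namespace Mediated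

open ExtensiveGame

variable {u : Fin 2 → (Fin 2 → Fin 2) → ℝ}

/-- With one plan, and the Nash action recommended after every first move, all information sets are
on the path. No unused action is ever recommended, so the game may have absolutely dominated
actions; the tremble order 3 is arbitrary. -/
theorem sequentiallyImplementable_of_isPureNash {B : Fin 2 → Type*} (b : ∀ i, Fin 2 ≃ B i)
    {v : Fin 2 → (∀ i, B i) → ℝ} (hv : ∀ i a, u i a = v i fun j => b j (a j))
    {a : Fin 2 → Fin 2} (ha : IsPureNash (A := fun _ => Fin 2) u a) {α : (∀ i, B i) → ℝ}
    (hα : ∀ a' : Fin 2 → Fin 2, α (fun j => b j (a' j)) = if a = a' then 1 else 0) :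
    SequentiallyImplementable v α := by
  classical
  set t₀ : Plan := (0, a 0, a 1) with ht₀
  have hout : t₀.outcome = a := pair_eta (A := fun _ => Fin 2) 0 a
  have hmsg : ∀ x, message (fun i _ => a (opp i)) t₀ x = a 1 := fun x => ite_self (a 1)
  have hs : ∀ t, t ≠ t₀ → (Pi.single t₀ 1 : Plan → ℝ) t = 0 := fun t ht =>
    Pi.single_eq_of_ne ht _
  refine sequentiallyImplementable (T := {t₀}) (pun := fun i _ => a (opp i))
    (ν := Pi.single t₀ 1) (e := fun _ => 3) b hv (single_mem_stdSimplex ℝ _)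
    (fun t ht => hs t (by simpa using ht)) (fun _ => by norm_num) (fun j y hy => .inl ?_)
    fun a' => ?_
  · have hinfo : info (fun i _ => a (opp i)) y = a j := by
      rcases isDecision_iff.1 hy with ⟨t, ht, rfl, rfl⟩ | ⟨t, ht, x, rfl, rfl⟩
      · obtain rfl := Finset.mem_singleton.1 ht
        rfl
      · obtain rfl := Finset.mem_singleton.1 ht
        exact hmsg x
    rw [hinfo, ObedientOnPath,
      Finset.sum_eq_single_of_mem t₀ (Finset.mem_univ _) fun t _ ht => by simp [hs t ht]]
    refine ⟨?_, fun c' => ?_⟩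
    · fin_cases j <;> simp [ht₀, opp]
    rw [Finset.sum_eq_single_of_mem t₀ (Finset.mem_univ _) fun t _ ht => by simp [hs t ht],
      hout, hmsg]
    fin_cases j
    · simpa [ht₀, opp] using ha 0 (profile 0 c' (a 1)) rfl
    · simpa [ht₀, opp] using ha 1 (profile 0 (a 0) c') rfl
  · rw [hα, Finset.sum_eq_single_of_mem t₀ (Finset.mem_univ _) fun t _ ht => by simp [hs t ht],
      hout, Pi.single_eq_same]

variable {α : (Fin 2 → Fin 2) → ℝ} {θ : (Fin 2 → Fin 2) → Fin 2 → ℝ}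
  {pun best : Fin 2 → Fin 2 → Fin 2}

/-- The action `c` of player `i` is not in the support of his marginal distribution. -/
def Unused (α : (Fin 2 → Fin 2) → ℝ) (i c : Fin 2) : Prop :=
  ∀ a, a i = c → α a = 0

theorem eq_of_ne_of_ne {x y z : Fin 2} (h : x ≠ z) (h' : y ≠ z) : x = y := by
  omega

/-- If neither player can have priority, each has an unused action `d i` whose best reply for him,
`best i (d i)`, is unused too. So `α` is a point mass on some `a`, and with two actions `a (opp i)`
is the worst the opponent can play against `d i`. The incentive constraint with that punishment is
then the Nash condition. -/
theorem exists_priority_or_isPureNash (hα : α ∈ stdSimplex ℝ (Fin 2 → Fin 2))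
    (hic : ∀ (i x x' : Fin 2) (w : ℝ), (∀ y, w ≤ u i (profile i x' y)) →
      Incentives (A := fun _ => Fin 2) u α θ i x x' w)
    (hbest : ∀ i x y, u i (profile i x y) ≤ u i (profile i x (best i x))) :
    (∃ p, ∀ c, Unused α p c → ¬ Unused α (opp p) (best p c)) ∨
      ∃ a, IsPureNash (A := fun _ => Fin 2) u a ∧ ∀ b, b ≠ a → α b = 0 := by
  by_cases h : ∃ p, ∀ c, Unused α p c → ¬ Unused α (opp p) (best p c)
  · exact .inl h
  right
  push Not at h
  choose d hd hd' using h
  obtain ⟨a, ha⟩ := exists_pos_of_mem_stdSimplex hα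
  have hsupp : ∀ c, α c ≠ 0 → ∀ i, c i ≠ d i := fun c hc i h => hc (hd i c h)
  have huniq : ∀ c, c ≠ a → α c = 0 := fun c hc => by
    by_contra h
    exact hc (funext fun i => eq_of_ne_of_ne (hsupp c h i) (hsupp a ha.ne' i))
  refine ⟨a, fun i b hb => ?_, huniq⟩
  by_cases hbi : b i = a i
  · exact (congrArg (u i) (profile_ext (A := fun _ => Fin 2) i hbi hb)).le
  have hbd : b i = d i := eq_of_ne_of_ne hbi (hsupp a ha.ne' i).symm
  have hb' : profile i (d i) (a (opp i)) = b :=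
    (pair_eq_iff (A := fun _ => Fin 2) i).2 ⟨hbd.symm, hb.symm⟩
  have h := hic i (a i) (d i) (u i b) fun y => by
    by_cases hy : y = a (opp i)
    · rw [hy, hb']
    · have : y = best i (d i) := eq_of_ne_of_ne hy fun h => ha.ne' (hd' i a h.symm)
      rw [this, ← hb']
      exact hbest _ _ _
  unfold Incentives at h
  rw [Finset.sum_eq_single_of_mem (a (opp i)) (Finset.mem_univ _), pair_eta] at h
  · have h' := nonneg_of_mul_nonneg_right h ha
    have hb'' : u i (pair (A := fun _ => Fin 2) i (d i) (a (opp i))) = u i b :=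
      congrArg (u i) hb'
    rw [hb''] at h'
    linarith
  · intro y _ hy
    rw [huniq, zero_mul]
    intro h
    exact hy ((pair_eq_iff (A := fun _ => Fin 2) i).1 h).2

theorem sum_plans (j c : Fin 2) (F G : Plan → ℝ) :
    ∑ t : Plan, ((if t.1 = j ∧ t.2.1 = c then F t else 0) +
      if opp t.1 = j ∧ t.2.2 = c then G t else 0) =
    ∑ y, (F (j, c, y) + G (opp j, y, c)) := by
  fin_cases j <;> fin_cases c <;>
    simp [Fintype.sum_prod_type, Fin.sum_univ_two, opp] <;> ring

/-- The distribution of plans that draws the intended profile from `α` and the first mover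
from `θ`. -/
def planDist (α : (Fin 2 → Fin 2) → ℝ) (θ : (Fin 2 → Fin 2) → Fin 2 → ℝ) (t : Plan) : ℝ :=
  α t.outcome * θ t.outcome t.1

theorem sum_planDist_mul (hθ : ∀ a, θ a ∈ stdSimplex ℝ (Fin 2)) (f : (Fin 2 → Fin 2) → ℝ) :
    ∑ t, planDist α θ t * f (Plan.outcome t) = ∑ a, α a * f a := by
  rw [Fintype.sum_prod_type]
  simp only [Fintype.sum_prod_type, planDist, Plan.outcome]
  have h : ∀ i : Fin 2, ∑ x : Fin 2, ∑ y : Fin 2,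
      α (profile i x y) * θ (profile i x y) i * f (profile i x y) = ∑ a, α a * θ a i * f a :=
    fun i => (sum_pair (A := fun _ => Fin 2) i fun a => α a * θ a i * f a).symm
  simp only [h]
  rw [Finset.sum_comm]
  refine Finset.sum_congr rfl fun a _ => ?_
  rw [← Finset.sum_mul, ← Finset.mul_sum, (hθ a).2, mul_one]

theorem planDist_mem_stdSimplex (hα : α ∈ stdSimplex ℝ (Fin 2 → Fin 2))
    (hθ : ∀ a, θ a ∈ stdSimplex ℝ (Fin 2)) : planDist α θ ∈ stdSimplex ℝ Plan := by
  refine ⟨fun t => mul_nonneg (hα.1 _) ((hθ _).1 _), ?_⟩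
  have := sum_planDist_mul (α := α) hθ fun _ => 1
  simpa [hα.2] using this

/-- The plans recommending `c` to `j` as first and as second mover split each `α (c, y)` in the
proportions `θ j` and `1 - θ j`, as in the ICE inequality. -/
theorem sum_planDist_mul_pair (hθ : ∀ a, θ a ∈ stdSimplex ℝ (Fin 2)) (j c : Fin 2)
    (f g : Fin 2 → ℝ) :
    ∑ y, (planDist α θ (j, c, y) * f y + planDist α θ (opp j, y, c) * g y) =
      ∑ y, α (profile j c y) *
        (θ (profile j c y) j * f y + (1 - θ (profile j c y) j) * g y) := by
  refine Finset.sum_congr rfl fun y _ => ?_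
  have h := (hθ (profile j c y)).2
  rw [sum_player j] at h
  simp only [planDist, Plan.outcome, profile_opp]
  rw [← h]
  ring

/-- A first mover who deviates is punished and a second mover who deviates faces the intended
action. Averaged over the unknown position, this is the incentive constraint. -/
theorem obedientOnPath_of_incentives (hα : α ∈ stdSimplex ℝ (Fin 2 → Fin 2))
    (hθ : ∀ a, θ a ∈ stdSimplex ℝ (Fin 2)) {j c : Fin 2} (hc : ¬ Unused α j c)
    (hic : ∀ c', Incentives (A := fun _ => Fin 2) u α θ j c c' (u j (profile j c' (pun j c')))) :
    ObedientOnPath pun u (planDist α θ) j c := by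
  unfold ObedientOnPath
  refine ⟨?_, fun c' => ?_⟩
  · rw [sum_plans]
    have := sum_planDist_mul_pair (α := α) hθ j c (fun _ => 1) fun _ => 1
    simp only [mul_one, add_sub_cancel] at this
    rw [this]
    unfold Unused at hc
    push Not at hc
    obtain ⟨a, rfl, ha⟩ := hc
    exact marginal_pos (A := fun _ => Fin 2) hα.1 (lt_of_le_of_ne (hα.1 a) ha.symm) j
  · rw [sum_plans, sum_planDist_mul_pair hθ]
    -- Obeying is no deviation and triggers no punishment: the gain is zero term by term.
    by_cases hcc : c' = c
    · refine (Finset.sum_eq_zero fun y _ => ?_).ge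
      simp [message, hcc, Plan.outcome, profile_opp]
    · refine (hic c').trans_eq (Finset.sum_congr rfl fun y _ => ?_)
      simp only [message, hcc, if_false, Plan.outcome, profile_opp]
      ring

open scoped Classical in
/-- The orders of the trembles of Nature. Plans that make credible the recommendation of an unused
action are the most likely ones, and those for player `p` come first. -/
noncomputable def trembleOrder (α : (Fin 2 → Fin 2) → ℝ) (best : Fin 2 → Fin 2 → Fin 2)
    (p : Fin 2) (t : Plan) : ℕ :=
  if Unused α t.1 t.2.1 ∧ t.2.2 = best t.1 t.2.1 then if t.1 = p then 1 else 2 else 3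

theorem obedientOffPath_of_unused {p j c : Fin 2}
    (hp : ∀ c, Unused α p c → ¬ Unused α (opp p) (best p c)) (hc : Unused α j c)
    (hcred : ∀ c', c' ≠ c → u j (profile j c' (pun j c')) ≤ u j (profile j c (best j c))) :
    ObedientOffPath Finset.univ pun u (planDist α θ) (trembleOrder α best p) j c := by
  refine ⟨?_, (j, c, best j c), Finset.mem_univ _, rfl, rfl, ?_, fun c' => ?_, ?_⟩
  · rintro ⟨i, x, y⟩ (⟨rfl, rfl⟩ | ⟨rfl, rfl⟩)
    · rw [planDist, hc _ (pair_self (A := fun _ => Fin 2) _ _ _), zero_mul]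
    · rw [planDist, hc _ (pair_opp (A := fun _ => Fin 2) _ _ _), zero_mul]
  · rw [trembleOrder, if_pos ⟨hc, rfl⟩]
    split_ifs <;> norm_num
  · by_cases h : c' = c
    · simp [message, h, Plan.outcome]
    · simpa [message, h] using hcred c' h
  · rintro ⟨i, x, y⟩ - hne (⟨rfl, rfl⟩ | ⟨rfl, rfl⟩)
    · have hy : y ≠ best i x := fun h => hne (by rw [h])
      have h3 : trembleOrder α best p (i, x, y) = 3 := if_neg fun h => hy h.2
      rw [h3, trembleOrder, if_pos ⟨hc, rfl⟩]
      split_ifs <;> norm_num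
    · rw [trembleOrder, if_pos ⟨hc, rfl⟩, trembleOrder]
      by_cases hsp : Unused α i x ∧ y = best i x
      · have hip : i ≠ p := by
          rintro rfl
          exact hp x hsp.1 (hsp.2 ▸ hc)
        have hjp : opp i = p := ((eq_or_eq_opp i p).resolve_left hip.symm).symm
        rw [if_pos hsp]
        simp [hip, hjp]
      · rw [if_neg hsp]
        split_ifs <;> norm_num

/-- In a game with two actions for each player and without absolutely dominated actions, every
distribution that satisfies the incentive constraints with arbitrary threats is sequentially
implementable. -/
theorem sequentiallyImplementable_of_incentives {B : Fin 2 → Type*} (b : ∀ i, Fin 2 ≃ B i)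
    {v : Fin 2 → (∀ i, B i) → ℝ} (hv : ∀ i a, u i a = v i fun j => b j (a j))
    (hα : α ∈ stdSimplex ℝ (Fin 2 → Fin 2)) (hθ : ∀ a, θ a ∈ stdSimplex ℝ (Fin 2))
    (hic : ∀ (i x x' : Fin 2) (w : ℝ), (∀ y, w ≤ u i (profile i x' y)) →
      Incentives (A := fun _ => Fin 2) u α θ i x x' w)
    (hnd : ∀ i x x', ¬ IsAbsolutelyDominated (A := fun _ => Fin 2) u i x x')
    {β : (∀ i, B i) → ℝ} (hβ : ∀ a : Fin 2 → Fin 2, β (fun j => b j (a j)) = α a) :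
    SequentiallyImplementable v β := by
  have hex : ∀ i x, ∃ y, ∀ y', u i (profile i x y') ≤ u i (profile i x y) :=
    fun i x => Finite.exists_max _
  have hex' : ∀ i x, ∃ y, ∀ y', u i (profile i x y) ≤ u i (profile i x y') :=
    fun i x => Finite.exists_min _
  choose best hbest using hex
  choose pun hpun using hex'
  rcases exists_priority_or_isPureNash hα hic hbest with ⟨p, hp⟩ | ⟨a, ha, ha'⟩
  · refine sequentiallyImplementable (T := Finset.univ) (pun := pun) (ν := planDist α θ)
      (e := trembleOrder α best p) b hv (planDist_mem_stdSimplex hα hθ)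
      (fun t ht => absurd (Finset.mem_univ t) ht) (fun t => ?_) (fun j y _ => ?_) fun a => ?_
    · rw [trembleOrder]
      split_ifs <;> norm_num
    · by_cases hc : Unused α j (info pun y)
      · refine .inr (obedientOffPath_of_unused hp hc fun c' _ => ?_)
        -- If even the best payoff from the recommendation were below the worst payoff from `c'`,
        -- the recommended action would be absolutely dominated.
        by_contra! h
        exact hnd j (info pun y) c' fun z z' =>
          (hbest j _ z).trans_lt (h.trans_le (hpun j _ z'))
      · exact .inl (obedientOnPath_of_incentives hα hθ hc fun c' => hic _ _ _ _ (hpun j c'))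
    · have := sum_planDist_mul (α := α) hθ fun a' => if a' = a then 1 else 0
      simpa [hβ] using this.symm
  · refine sequentiallyImplementable_of_isPureNash b hv ha fun a' => ?_
    rw [hβ]
    split_ifs with h
    · have := hα.2
      rw [Finset.sum_eq_single_of_mem a (Finset.mem_univ _) fun c _ hc => ha' c hc] at this
      rw [← h, this]
    · exact ha' _ (Ne.symm h)

end Mediated

/-! ### Relabelling the actions, and the conclusion. -/

section Transport

variable {A : Fin 2 → Type*} (b : ∀ i, Fin 2 ≃ A i)

theorem relabel_pair (i x y : Fin 2) :
    (fun j => b j (Mediated.profile i x y j)) = pair i (b i x) (b (opp i) y) :=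
  profile_ext i (by simp) (by simp)

variable [∀ i, Fintype (A i)] {u : Fin 2 → (∀ i, A i) → ℝ} {α : (∀ i, A i) → ℝ}

theorem sum_relabel (f : (∀ i, A i) → ℝ) :
    ∑ a : Fin 2 → Fin 2, f (fun j => b j (a j)) = ∑ a, f a :=
  Fintype.sum_equiv (Equiv.piCongrRight b) _ _ fun _ => rfl

theorem incentives_relabel {θ : (∀ i, A i) → Fin 2 → ℝ} {i x x' : Fin 2} {w : ℝ}
    (h : Incentives u α θ i (b i x) (b i x') w) :
    Incentives (A := fun _ => Fin 2) (fun i a => u i fun j => b j (a j))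
      (fun a => α fun j => b j (a j)) (fun a => θ fun j => b j (a j)) i x x' w := by
  refine h.trans_eq ?_
  rw [← (b (opp i)).sum_comp]
  refine Finset.sum_congr rfl fun y _ => ?_
  simp only [← relabel_pair]

theorem IsICE.sequentiallyImplementable (hA : ∀ i, Fintype.card (A i) = 2)
    (hnd : ∀ i x x', ¬ IsAbsolutelyDominated u i x x')
    (h : IsICE u (fun _ => Set.univ) α) : SequentiallyImplementable u α := by
  set b : ∀ i, Fin 2 ≃ A i := fun i => (Fintype.equivFinOfCardEq (hA i)).symm
  obtain ⟨hα, θ, hθ, hic⟩ := h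
  refine Mediated.sequentiallyImplementable_of_incentives (u := fun i a => u i fun j => b j (a j))
    (α := fun a => α fun j => b j (a j)) (θ := fun a => θ fun j => b j (a j)) b
    (fun _ _ => rfl) ⟨fun a => hα.1 _, (sum_relabel b α).trans hα.2⟩ (fun a => hθ _)
    (fun i x x' w hw => incentives_relabel b ?_) (fun i x x' hd => ?_) fun _ => rfl
  · refine Incentives.anti hα.1 (fun a => (hθ a).1)
      (le_worstPayoff (effectiveThreats_nonempty hα _ _) fun y _ => ?_) (hic i _ _)
    have := hw ((b (opp i)).symm y)
    rwa [relabel_pair, Equiv.apply_symm_apply] at this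
  · refine hnd i (b i x) (b i x') fun y y' => ?_
    have := hd ((b (opp i)).symm y) ((b (opp i)).symm y')
    change u i (fun j => b j (Mediated.profile i _ _ j)) <
      u i (fun j => b j (Mediated.profile i _ _ j)) at this
    rwa [relabel_pair, relabel_pair, Equiv.apply_symm_apply, Equiv.apply_symm_apply] at this

theorem IsPureNash.sequentiallyImplementable (hA : ∀ i, Fintype.card (A i) = 2)
    (hα : α ∈ stdSimplex ℝ (∀ i, A i)) {a : ∀ i, A i} (ha : IsPureNash u a)
    (h0 : ∀ c, c ≠ a → α c = 0) : SequentiallyImplementable u α := by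
  set b : ∀ i, Fin 2 ≃ A i := fun i => (Fintype.equivFinOfCardEq (hA i)).symm
  refine Mediated.sequentiallyImplementable_of_isPureNash
    (u := fun i a => u i fun j => b j (a j)) b (fun _ _ => rfl)
    (a := fun j => (b j).symm (a j)) (fun i c hc => ?_) fun a' => ?_
  · simp only [Equiv.apply_symm_apply]
    exact ha i _ (by simp [hc])
  · split_ifs with h
    · rw [← h]
      simp only [Equiv.apply_symm_apply]
      have := hα.2
      rwa [Finset.sum_eq_single_of_mem a (Finset.mem_univ _) fun c _ hc => h0 c hc] at this
    · refine h0 _ fun h' => h ?_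
      simp [← h']

end Transport

/-- With two actions for each player and no repeated payoffs, sequential implementability
is the same as being an interdependent-choice equilibrium with C-rationalizable threats. -/
theorem sequentiallyImplementable_iff_isICE {A : Fin 2 → Type*} [∀ i, Fintype (A i)]
    (hA : ∀ i, Fintype.card (A i) = 2) {u : Fin 2 → (∀ i, A i) → ℝ} (hu : NoRepeatedPayoffs u)
    {α : (∀ i, A i) → ℝ} (hα : α ∈ stdSimplex ℝ (∀ i, A i)) :
    SequentiallyImplementable u α ↔ IsICE u (cRationalizable u) α := by
  have : ∀ i, Nontrivial (A i) := fun i =>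
    Fintype.one_lt_card_iff_nontrivial.1 (by rw [hA]; norm_num)
  by_cases h : ∃ i d d', IsAbsolutelyDominated u i d d'
  · obtain ⟨i, d, d', hd⟩ := h
    -- With only two actions, an absolutely dominated one leaves a single alternative.
    have hdd : ∀ x : A i, x = d ∨ x = d' := by
      intro x
      have e := Fintype.equivFinOfCardEq (hA i)
      have h1 := e.injective.ne hd.ne
      by_contra! hx
      have h2 := e.injective.ne hx.1
      have h3 := e.injective.ne hx.2
      omega
    constructor
    · intro h
      obtain ⟨a, ha, h0⟩ := h.exists_isPureNash hα hu hdd hd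
      exact isICE_of_isPureNash _ hα h0 ha
    · intro h
      obtain ⟨a, ha, h0⟩ := h.exists_isPureNash hu hdd hd
      exact ha.sequentiallyImplementable hA hα h0
  · push Not at h
    have hcr : cRationalizable u = fun _ => Set.univ := funext (cRationalizable_eq_univ h)
    rw [hcr]
    exact ⟨fun h' => h'.isICE hα, fun h' => h'.sequentiallyImplementable hA h⟩

end InterdependentChoice

theorem mainTheorem4 {A : Fin 2 → Type*} [∀ i, Fintype (A i)]
    (hA : ∀ i, Fintype.card (A i) = 2)
    (u : Fin 2 → (∀ i, A i) → ℝ) (hu : InterdependentChoice.NoRepeatedPayoffs u)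
    (α : (∀ i, A i) → ℝ) (hα : α ∈ stdSimplex ℝ (∀ i, A i)) :
    InterdependentChoice.SequentiallyImplementable u α ↔
      InterdependentChoice.IsICE u (InterdependentChoice.cRationalizable u) α :=
  InterdependentChoice.sequentiallyImplementable_iff_isICE hA hu hα
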